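/- **Conventions.** Let $\mathbb Q$ denote the real quaternions and $U(\mathbb Q)=\{q\in\mathbb Q:|q|=1\}$. A $U(\mathbb Q)$-gain graph $\widetilde G$ is a finite simple graph $G$ together with a gain $\varphi_{uv}\in U(\mathbb Q)$ for every oriented edge $uv$, such that $\varphi_{vu}=\varphi_{uv}^{-1}$. Its adjacency matrix has the entry $\varphi_{uv}$ at $(u,v)$ if $u,v$ are adjacent, and $0$ otherwise; its rank $r(\widetilde G)$ is the left row rank of this matrix, i.e. the maximum number of left linearly independent rows. The graph is connected bicyclic if it is connected and $|E(G)|=|V(G)|+1$; a pendant vertex is a vertex of degree $1$. The gain of the cycle $v_1v_2\cdots v_nv_1$ is $\varphi(v_1v_2\cdots v_nv_1)=\varphi_{v_1v_2}\cdots\varphi_{v_{n-1}v_n}\varphi_{v_nv_1}$. A cycle $C$ of length $n$ with gain $\varphi(C)$ is of Type 1 if $n$ is even and $\varphi(C)=(-1)^{n/2}$; of Type 2 if $n$ is even and $\varphi(C)\ne(-1)^{n/2}$; of Type 3 if $n$ is odd and $\mathrm{Re}\big((-1)^{(n-1)/2}\varphi(C)\big)\neq0$; of Type 4 if $n$ is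 odd and $\mathrm{Re}\big((-1)^{(n-1)/2}\varphi(C)\big)=0$. Write $(a_1a_2\cdots a_n)$ for the cycle $v_{a_1}v_{a_2}\cdots v_{a_n}v_{a_1}$. Consider the following eleven graphs, with vertices $v_1,\dots,v_n$: * $G_1$ ($n=5$): the triangles $(132)$ and $(154)$ sharing $v_1$; * $G_2$ ($n=6$): the triangle $(123)$ and the 4-cycle $(3456)$ sharing $v_3$; * $G_3$ ($n=7$): the 4-cycles $(1243)$ and $(4567)$ sharing $v_4$; * $G_4$ ($n=6$): the disjoint triangles $(132)$ and $(465)$ joined by the edge $v_1v_4$; * $G_5$ ($n=4$): the cycle $(1234)$ with the chord $v_2v_4$; * $G_6$ ($n=5$): the cycle $(12345)$ with the chord $v_2v_5$; * $G_7$ ($n=6$): the cycle $(123456)$ with the chord $v_2v_6$; * $G_8$ ($n=6$): the cycle $(123456)$ with the chord $v_2v_5$; * $G_9$ ($n=5$): the cycle $(1234)$ and the path $v_2v_5v_4$; * $G_{10}$ ($n=6$): the cycle $(12345)$ and the path $v_2v_6v_5$; * $G_{11}$ ($n=7$): the cycle $(123456)$ and the path $v_2v_7v_6$. **Theorem.**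 Let $\widetilde G$ be a connected bicyclic $U(\mathbb Q)$-gain graph without pendant vertices. Then, for each $r\in\{2,3,4\}$, $r(\widetilde G)=r$ if and only if the vertices of $\widetilde G$ can be labelled so that the underlying graph is one of $G_1,\dots,G_{11}$ and a gain condition is listed below for that graph and rank $r$, and holds. Moreover, for every labelling of the vertices of $\widetilde G$ under which the underlying graph is $G_i$, one has $r(\widetilde G)=r$ if and only if the condition listed for $G_i$ and rank $r$ holds; if nothing is listed (in particular for $G_4$, for all three ranks), $r(\widetilde G)\ne r$. *Rank 2:* * $G_5$: $(124)$ is of Type 4 and $(1234)$ is of Type 1. * $G_9$: $(1254)$ and $(1234)$ are of Type 1. *Rank 3:* * $G_5$: $(124)$ is of Type 3 and $(1234)$ is of Type 1. *Rank 4:* * $G_1$: $\mathrm{Re}\,\varphi(v_1v_3v_2v_1)+\mathrm{Re}\,\varphi(v_1v_5v_4v_1)=0$. * $G_2$: $(3456)$ is of Type 1 and $(123)$ is of Type 4. * $G_3$: $(1243)$ and $(4567)$ are of Type 1. * $G_5$: $(124)$ is of Type 3 or 4 and $(1234)$ is of Type 2. * $G_6$: $\mathrm{Re}\,\varphi(v_1v_2v_5v_1)-\mathrm{Re}\,\varphi(v_1v_2v_3v_4v_5v_1)=0$.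 * $G_7$: $(126)$ is of Type 4 and $(123456)$ is of Type 1. * $G_8$: $\varphi(v_1v_2v_3v_4v_5v_6v_1)-\varphi(v_1v_2v_5v_6v_1)+1=0$. * $G_9$: $(1234)$ is of Type 1 and $(1254)$ is of Type 2; or $(1234)$ is of Type 2 and $(1254)$ is of Type 1 or 2. * $G_{10}$: $(1265)$ is of Type 1 and $(12345)$ is of Type 4. * $G_{11}$: $(1276)$ and $(123456)$ are of Type 1. -/

import Mathlib

open scoped Quaternion

noncomputable section

namespace QuaternionGain

/-- The left row rank of a quaternion matrix: the maximum number of rows that are left linearly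
independent. Row vectors are regarded as elements of the left `ℍ`-module `n → ℍ`. -/
def leftRowRank {m n : Type*} [Fintype m] (A : Matrix m n ℍ[ℝ]) : ℕ :=
  sSup {k : ℕ | ∃ s : Finset m, LinearIndependent ℍ[ℝ] (fun i : s => A i) ∧ s.card = k}

/-- A quaternion unit gain graph with vertex set `V`: a simple graph together with a gain in the
group of unit quaternions for every oriented edge, reversing an edge inverting the gain. -/
structure UQGainGraph (V : Type*) where
  graph : SimpleGraph V
  gain : ∀ {u v : V}, graph.Adj u v → Metric.sphere (0 : ℍ[ℝ]) 1
  gain_symm : ∀ {u v : V} (h : graph.Adj u v), gain h.symm = (gain h)⁻¹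

namespace UQGainGraph

variable {V : Type*}

open Classical in
/-- The adjacency matrix: the gain of the oriented edge `uv`, and `0` for non-adjacent pairs. -/
def adjMatrix (Γ : UQGainGraph V) : Matrix V V ℍ[ℝ] :=
  fun u v => if h : Γ.graph.Adj u v then (Γ.gain h : ℍ[ℝ]) else 0

/-- The rank of a gain graph is the left row rank of its adjacency matrix. -/
def rank [Fintype V] (Γ : UQGainGraph V) : ℕ := leftRowRank Γ.adjMatrix

/-- A bicyclic graph: connected, with one more edge than vertices. -/
def IsConnectedBicyclic [Fintype V] (Γ : UQGainGraph V) : Prop :=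
  Γ.graph.Connected ∧ Γ.graph.edgeSet.ncard = Fintype.card V + 1

/-- A pendant vertex is a vertex of degree one. -/
def IsPendant (Γ : UQGainGraph V) (v : V) : Prop := (Γ.graph.neighborSet v).ncard = 1

/-- The gain `φ(v₁v₂) φ(v₂v₃) ⋯ φ(vₖ₋₁vₖ)` of a walk given by its sequence of vertices
`v₁, v₂, …, vₖ` (in which consecutive vertices are adjacent). -/
def walkGain (Γ : UQGainGraph V) : List V → ℍ[ℝ]
  | [] => 1
  | [_] => 1
  | u :: v :: l => Γ.adjMatrix u v * walkGain Γ (v :: l)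

/-- The gain `φ(v₁v₂) ⋯ φ(vₙ₋₁vₙ) φ(vₙv₁)` of the cycle whose vertices are, in cyclic order,
`v₁, …, vₙ`. -/
def cycleGain (Γ : UQGainGraph V) : List V → ℍ[ℝ]
  | [] => 1
  | u :: l => Γ.walkGain (u :: (l ++ [u]))

/-- The cycle with vertices `c` (in cyclic order) is of Type 1. -/
def Type1 (Γ : UQGainGraph V) (c : List V) : Prop :=
  Even c.length ∧ Γ.cycleGain c = (-1) ^ (c.length / 2)

/-- The cycle with vertices `c` (in cyclic order) is of Type 2. -/
def Type2 (Γ : UQGainGraph V) (c : List V) : Prop :=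
  Even c.length ∧ Γ.cycleGain c ≠ (-1) ^ (c.length / 2)

/-- The cycle with vertices `c` (in cyclic order) is of Type 3. -/
def Type3 (Γ : UQGainGraph V) (c : List V) : Prop :=
  Odd c.length ∧ ((-1) ^ ((c.length - 1) / 2) * Γ.cycleGain c).re ≠ 0

/-- The cycle with vertices `c` (in cyclic order) is of Type 4. -/
def Type4 (Γ : UQGainGraph V) (c : List V) : Prop :=
  Odd c.length ∧ ((-1) ^ ((c.length - 1) / 2) * Γ.cycleGain c).re = 0

end UQGainGraph

/-! The eleven underlying graphs. A graph of order `n` has the vertices `1, 2, …, n`, regarded as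
elements of `Fin n`, where the numeral `n` denotes the same element as `0`. Below,
`∞(p,l,q)` consists of two cycles of lengths `p` and `q` joined by a path on `l` vertices (sharing
a vertex if `l = 1`), and `θ(p,l,q)` of three paths with `p`, `l` and `q` inner vertices and the
same two end vertices. -/

/-- `∞(3,1,3)`: triangles `1 3 2` and `1 5 4`. -/
def G1 : SimpleGraph (Fin 5) :=
  SimpleGraph.fromEdgeSet {s(1, 3), s(3, 2), s(2, 1), s(1, 5), s(5, 4), s(4, 1)}

/-- `∞(3,1,4)`: triangle `1 2 3` and quadrangle `3 4 5 6`. -/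
def G2 : SimpleGraph (Fin 6) :=
  SimpleGraph.fromEdgeSet {s(1, 2), s(2, 3), s(3, 1), s(3, 4), s(4, 5), s(5, 6), s(6, 3)}

/-- `∞(4,1,4)`: quadrangles `1 2 4 3` and `4 5 6 7`. -/
def G3 : SimpleGraph (Fin 7) :=
  SimpleGraph.fromEdgeSet
    {s(1, 2), s(2, 4), s(4, 3), s(3, 1), s(4, 5), s(5, 6), s(6, 7), s(7, 4)}

/-- `∞(3,2,3)`: triangles `1 3 2` and `4 6 5`, and the edge `1 4`. -/
def G4 : SimpleGraph (Fin 6) :=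
  SimpleGraph.fromEdgeSet {s(1, 3), s(3, 2), s(2, 1), s(4, 6), s(6, 5), s(5, 4), s(1, 4)}

/-- `θ(0,1,1)`: cycle `1 2 3 4` and the chord `2 4`. -/
def G5 : SimpleGraph (Fin 4) :=
  SimpleGraph.fromEdgeSet {s(1, 2), s(2, 3), s(3, 4), s(4, 1), s(2, 4)}

/-- `θ(0,1,2)`: cycle `1 2 3 4 5` and the chord `2 5`. -/
def G6 : SimpleGraph (Fin 5) :=
  SimpleGraph.fromEdgeSet {s(1, 2), s(2, 3), s(3, 4), s(4, 5), s(5, 1), s(2, 5)}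

/-- `θ(0,1,3)`: cycle `1 2 3 4 5 6` and the chord `2 6`. -/
def G7 : SimpleGraph (Fin 6) :=
  SimpleGraph.fromEdgeSet {s(1, 2), s(2, 3), s(3, 4), s(4, 5), s(5, 6), s(6, 1), s(2, 6)}

/-- `θ(0,2,2)`: cycle `1 2 3 4 5 6` and the chord `2 5`. -/
def G8 : SimpleGraph (Fin 6) :=
  SimpleGraph.fromEdgeSet {s(1, 2), s(2, 3), s(3, 4), s(4, 5), s(5, 6), s(6, 1), s(2, 5)}

/-- `θ(1,1,1)`: cycle `1 2 3 4` and the path `2 5 4`. -/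
def G9 : SimpleGraph (Fin 5) :=
  SimpleGraph.fromEdgeSet {s(1, 2), s(2, 3), s(3, 4), s(4, 1), s(2, 5), s(5, 4)}

/-- `θ(1,1,2)`: cycle `1 2 3 4 5` and the path `2 6 5`. -/
def G10 : SimpleGraph (Fin 6) :=
  SimpleGraph.fromEdgeSet {s(1, 2), s(2, 3), s(3, 4), s(4, 5), s(5, 1), s(2, 6), s(6, 5)}

/-- `θ(1,1,3)`: cycle `1 2 3 4 5 6` and the path `2 7 6`. -/
def G11 : SimpleGraph (Fin 7) :=
  SimpleGraph.fromEdgeSet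
    {s(1, 2), s(2, 3), s(3, 4), s(4, 5), s(5, 6), s(6, 1), s(2, 7), s(7, 6)}

/-! For each underlying graph `G1`, …, `G11`, the predicate `tab1`, …, `tab11` is the gain condition
listed for this graph and the rank `r`, for the gain graph `Γ` with its vertices labelled by `v`.
It is false if nothing is listed for this graph and this rank. -/

namespace UQGainGraph

variable {V : Type*}

def tab1 (Γ : UQGainGraph V) (v : Fin 5 → V) (r : ℕ) : Prop :=
  r = 4 ∧ (Γ.cycleGain [v 1, v 3, v 2]).re + (Γ.cycleGain [v 1, v 5, v 4]).re = 0

def tab2 (Γ : UQGainGraph V) (v : Fin 6 → V) (r : ℕ) : Prop :=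
  r = 4 ∧ Γ.Type1 [v 3, v 4, v 5, v 6] ∧ Γ.Type4 [v 1, v 2, v 3]

def tab3 (Γ : UQGainGraph V) (v : Fin 7 → V) (r : ℕ) : Prop :=
  r = 4 ∧ Γ.Type1 [v 1, v 2, v 4, v 3] ∧ Γ.Type1 [v 4, v 5, v 6, v 7]

def tab4 (_Γ : UQGainGraph V) (_v : Fin 6 → V) (_r : ℕ) : Prop := False

def tab5 (Γ : UQGainGraph V) (v : Fin 4 → V) (r : ℕ) : Prop :=
  (r = 2 ∧ Γ.Type4 [v 1, v 2, v 4] ∧ Γ.Type1 [v 1, v 2, v 3, v 4]) ∨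
  (r = 3 ∧ Γ.Type3 [v 1, v 2, v 4] ∧ Γ.Type1 [v 1, v 2, v 3, v 4]) ∨
  (r = 4 ∧ (Γ.Type3 [v 1, v 2, v 4] ∨ Γ.Type4 [v 1, v 2, v 4]) ∧
    Γ.Type2 [v 1, v 2, v 3, v 4])

def tab6 (Γ : UQGainGraph V) (v : Fin 5 → V) (r : ℕ) : Prop :=
  r = 4 ∧ (Γ.cycleGain [v 1, v 2, v 5]).re - (Γ.cycleGain [v 1, v 2, v 3, v 4, v 5]).re = 0

def tab7 (Γ : UQGainGraph V) (v : Fin 6 → V) (r : ℕ) : Prop :=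
  r = 4 ∧ Γ.Type4 [v 1, v 2, v 6] ∧ Γ.Type1 [v 1, v 2, v 3, v 4, v 5, v 6]

def tab8 (Γ : UQGainGraph V) (v : Fin 6 → V) (r : ℕ) : Prop :=
  r = 4 ∧
    Γ.cycleGain [v 1, v 2, v 3, v 4, v 5, v 6] - Γ.cycleGain [v 1, v 2, v 5, v 6] + 1 = 0

def tab9 (Γ : UQGainGraph V) (v : Fin 5 → V) (r : ℕ) : Prop :=
  (r = 2 ∧ Γ.Type1 [v 1, v 2, v 5, v 4] ∧ Γ.Type1 [v 1, v 2, v 3, v 4]) ∨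
  (r = 4 ∧
    ((Γ.Type1 [v 1, v 2, v 3, v 4] ∧ Γ.Type2 [v 1, v 2, v 5, v 4]) ∨
     (Γ.Type2 [v 1, v 2, v 3, v 4] ∧
       (Γ.Type1 [v 1, v 2, v 5, v 4] ∨ Γ.Type2 [v 1, v 2, v 5, v 4]))))

def tab10 (Γ : UQGainGraph V) (v : Fin 6 → V) (r : ℕ) : Prop :=
  r = 4 ∧ Γ.Type1 [v 1, v 2, v 6, v 5] ∧ Γ.Type4 [v 1, v 2, v 3, v 4, v 5]

def tab11 (Γ : UQGainGraph V) (v : Fin 7 → V) (r : ℕ) : Prop :=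
  r = 4 ∧ Γ.Type1 [v 1, v 2, v 7, v 6] ∧ Γ.Type1 [v 1, v 2, v 3, v 4, v 5, v 6]

end UQGainGraph

end QuaternionGain

end

noncomputable section

namespace QuaternionGain

/-! ### Exhaustive unfolding of a graph -/

namespace Unfolding

/-! Two independent arguments meet here.

The first bounds the underlying graph. Suppose that row i_k of the adjacency matrix is nonzero in
column j_k and zero in all later columns j_(k+1), j_(k+2), …. A triangular array of this kind bounds
the rank from below by its length, whatever the gains (`IsTriangular.length_le`). Rank at most 4
therefore excludes arrays of length five, a condition on the graph alone. Without pendant vertices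
all degrees are at least 2, and |E| = |V| + 1 makes them exceed 2 by exactly 2 in total. Such a
graph is uncovered from a vertex of degree 3 or 4, one neighbourhood at a time. Uncovered
neighbourhoods are complete, so a triangular array found among them is one of the whole graph and
closes the branch. The computation `search_three_and_four` shows that the tree of possibilities is
finite and that only ten of the eleven graphs survive; `G4` does not.

The second computes the rank on each labelled graph. Since A(u,v)⁻¹ = A(v,u), eliminating with both
entries of an edge uv subtracts from the entry (x,y) the gains of the walks x,v,u,y and x,u,v,y, and
lowers the rank by 2 (`rowSpaceDim_eq_add_two`). After one or two disjoint edges are eliminated, few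
entries remain. An off-diagonal entry compares paths with common ends; each elimination contributes
a sign, whence the (-1)^(n/2) in Type 1. A diagonal entry is, up to sign, q plus its conjugate, so
that only the real part of the gain of an odd cycle matters. The rank of this residue, added to 2 or
4, gives the listed conditions. -/

/-- Evaluate `n` before it is passed to `k`; this only affects the speed of evaluation. -/
def evalNat {α : Type} (n : ℕ) (k : ℕ → α) : α :=
  match n with
  | 0 => k 0 | 1 => k 1 | 2 => k 2 | 3 => k 3 | 4 => k 4 | 5 => k 5 | 6 => k 6 | 7 => k 7
  | 8 => k 8 | 9 => k 9 | 10 => k 10 | n + 11 => k (n + 11)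

/-- Evaluate `l` before it is passed to `k`; this only affects the speed of evaluation. -/
def evalList {α : Type} : List ℕ → (List ℕ → α) → α
  | [], k => k []
  | x :: l, k => evalNat x fun x => evalList l fun l => k (x :: l)

theorem evalNat_eq {α : Type} (n : ℕ) (k : ℕ → α) : evalNat n k = k n := by
  unfold evalNat
  split <;> rfl

theorem evalList_eq {α : Type} (l : List ℕ) (k : List ℕ → α) : evalList l k = k l := by
  induction l generalizing k with
  | nil => rfl
  | cons x l ih => simp [evalList, evalNat_eq, ih]

/-- Membership in a list of natural numbers. -/
def mem (x : ℕ) (l : List ℕ) : Bool := l.any fun y => Nat.beq x y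

/-- The unique element outside `S` of some list of `rows` that has exactly one such element. -/
def forced (rows : List (List ℕ)) (S : List ℕ) : Option ℕ :=
  rows.findSome? fun r => match r.filter (fun j => !mem j S) with
    | [y] => some y
    | _ => none

/-- Whether `k` vertices can be forced successively, starting from `S`, where `rows` are the
neighbour lists of the available vertices. -/
def forces (rows : List (List ℕ)) : ℕ → List ℕ → Bool
  | 0, _ => true
  | k + 1, S => match forced rows S with
    | none => false
    | some y => evalNat y fun y => forces rows k (y :: S)

/-- Whether five of the vertices `0, …, m - 1` can be forced from the others. -/
def hasRankFive (rows : List (List ℕ)) (m : ℕ) : Bool :=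
  Nat.ble 5 rows.length &&
    ((List.range m).sublistsLen (m - 5)).any fun S => evalList S fun S => forces rows 5 S

/-- Whether `σ` is an injective map on `{0, …, k - 1}` preserving and reflecting adjacency. -/
def isEmbedding (p rows : List (List ℕ)) (k : ℕ) (σ : List ℕ) : Bool :=
  (List.range k).all fun i => (List.range k).all fun j =>
    (mem j (p.getD i []) == mem (σ.getD j 0) (rows.getD (σ.getD i 0) [])) &&
      (Nat.beq i j || !Nat.beq (σ.getD i 0) (σ.getD j 0))

/-- Backtracking search for an isomorphism between two graphs given by neighbour lists. -/
def extendsTo (p rows : List (List ℕ)) : ℕ → List ℕ → Bool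
  | 0, σ => isEmbedding p rows p.length σ && σ.all (fun x => Nat.blt x p.length) &&
      Nat.beq σ.length p.length
  | k + 1, σ => (List.range p.length).any fun x =>
      Nat.beq (p.getD σ.length []).length (rows.getD x []).length && evalList (σ ++ [x]) fun σ =>
        isEmbedding p rows σ.length σ && extendsTo p rows k σ

/-- Whether two graphs given by neighbour lists are isomorphic. -/
def isIso (p rows : List (List ℕ)) : Bool :=
  Nat.beq p.length rows.length && extendsTo p rows p.length []

/-- The neighbour lists of the graphs `G1`, `G2`, `G3`, `G5`, …, `G11`. -/
def patterns : List (List (List ℕ)) :=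
  [[[1, 4], [3, 2, 0, 4], [3, 1], [1, 2], [0, 1]],
   [[5, 3], [2, 3], [1, 3], [2, 1, 4, 0], [3, 5], [4, 0]],
   [[6, 4], [2, 3], [1, 4], [4, 1], [2, 3, 5, 0], [4, 6], [5, 0]],
   [[3, 1, 2], [2, 0], [1, 3, 0], [2, 0]],
   [[4, 1, 2], [2, 0], [1, 3, 0], [2, 4], [3, 0]],
   [[5, 1, 2], [2, 0], [1, 3, 0], [2, 4], [3, 5], [4, 0]],
   [[5, 1], [2, 0], [1, 3, 5], [2, 4], [3, 5], [4, 0, 2]],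
   [[2, 4], [2, 4], [1, 3, 0], [2, 4], [3, 1, 0]],
   [[2, 5], [2, 5], [1, 3, 0], [2, 4], [3, 5], [4, 1, 0]],
   [[2, 6], [2, 6], [1, 3, 0], [2, 4], [3, 5], [4, 6], [5, 1, 0]]]

/-- The neighbours of the vertex `rows.length` among the vertices with the neighbour lists
`rows`. -/
def knownNeighbours (rows : List (List ℕ)) : List ℕ :=
  (List.range rows.length).filter fun j => mem rows.length (rows.getD j [])

/-- Explore all graphs of minimum degree at least two with seen vertices `0, …, m - 1`, the first
of which have the neighbour lists `rows`, and the degrees of the other ones exceeding two by `b` in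
total. The result is `true` if each of them has a triangular array of five adjacencies or is
isomorphic to one of the `patterns`. -/
def search : ℕ → List (List ℕ) → ℕ → ℕ → Bool
  | 0, _, _, _ => false
  | fuel + 1, rows, m, b =>
    hasRankFive rows m ||
    bif Nat.beq rows.length m then !Nat.beq b 0 || patterns.any fun p => isIso p rows
    else
      (List.range' (rows.length + 1) (m - (rows.length + 1))).sublists.all fun S =>
        (List.range (b + 3)).all fun c =>
          evalList (knownNeighbours rows ++ S ++ List.range' m c) fun row =>
            Nat.blt row.length 2 || Nat.blt (b + 2) row.length ||
              evalNat (m + c) fun m => evalNat (b + 2 - row.length) fun b =>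
                search fuel (rows ++ [row]) m b

/-- The two starting points are a first vertex of degree 3 or 4, which leaves an excess of 1 or 0
out of the total 2. Every branch closes within the fuel 8. `G4` need not be a pattern because a
triangular array of length five cuts its branches. -/
theorem search_three_and_four :
    (search 8 [[1, 2, 3]] 4 1 && search 8 [[1, 2, 3, 4]] 5 0) = true := by
  decide +kernel

end Unfolding

/-- A list of adjacent pairs such that no first component is adjacent to a later second
component. -/
def IsTriangular {V : Type*} (G : SimpleGraph V) (l : List (V × V)) : Prop :=
  (∀ p ∈ l, G.Adj p.1 p.2) ∧ l.Pairwise fun p q => ¬ G.Adj p.1 q.2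

/-! ### Soundness of the search. -/

namespace Unfolding

theorem mem_iff {x : ℕ} {l : List ℕ} : mem x l = true ↔ x ∈ l := by
  simp [mem]

theorem exists_of_forced {rows : List (List ℕ)} {S : List ℕ} {y : ℕ} (h : forced rows S = some y) :
    ∃ i < rows.length, ∀ j, (j ∈ rows.getD i [] ∧ j ∉ S) ↔ j = y := by
  obtain ⟨r, hr, h⟩ := List.exists_of_findSome?_eq_some h
  obtain ⟨i, hi, rfl⟩ := List.mem_iff_getElem.1 hr
  refine ⟨i, hi, fun j => ?_⟩
  split at h
  · rename_i z hz
    obtain rfl : z = y := by simpa using h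
    have : j ∈ rows[i].filter (fun j => !mem j S) ↔ j ∈ [z] := by rw [hz]
    simpa [← mem_iff, hi] using this
  · simp at h

/-- The order of forcing is the triangular order: row `i` has `y` as its only element outside `S`,
and the vertices forced later avoid both `S` and `y`, hence do not occur in row `i`. -/
theorem exists_of_forces {rows : List (List ℕ)} {k : ℕ} {S : List ℕ} (h : forces rows k S = true) :
    ∃ l : List (ℕ × ℕ), l.length = k ∧
      (∀ p ∈ l, p.1 < rows.length ∧ p.2 ∈ rows.getD p.1 [] ∧ p.2 ∉ S) ∧
      l.Pairwise fun p q => q.2 ∉ rows.getD p.1 [] := by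
  induction k generalizing S with
  | zero => exact ⟨[], by simp⟩
  | succ k ih =>
    rw [forces] at h
    split at h
    · simp at h
    · rename_i y hy
      rw [evalNat_eq] at h
      obtain ⟨i, hi, hiy⟩ := exists_of_forced hy
      obtain ⟨l, hl, hlS, hlp⟩ := ih h
      have hyr := (hiy y).2 rfl
      refine ⟨(i, y) :: l, by simp [hl], ?_, List.pairwise_cons.2 ⟨?_, hlp⟩⟩
      · simp only [List.mem_cons, forall_eq_or_imp]
        refine ⟨⟨hi, hyr⟩, fun p hp => ?_⟩
        have := hlS p hp
        simp only [List.mem_cons, not_or] at this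
        exact ⟨this.1, this.2.1, this.2.2.2⟩
      · intro q hq hqi
        have := (hlS q hq).2.2
        simp only [List.mem_cons, not_or] at this
        exact this.1 ((hiy q.2).1 ⟨hqi, this.2⟩)

/-- Only the test at the leaf is needed for soundness; the tests along the way merely prune the
backtracking. -/
theorem exists_of_extendsTo {p rows : List (List ℕ)} {k : ℕ} {σ : List ℕ}
    (h : extendsTo p rows k σ = true) :
    ∃ τ : List ℕ, isEmbedding p rows p.length τ = true ∧ (∀ x ∈ τ, x < p.length) ∧
      τ.length = p.length := by
  induction k generalizing σ with
  | zero =>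
    simp only [extendsTo, Bool.and_eq_true, List.all_eq_true] at h
    exact ⟨σ, h.1.1, fun x hx => by simpa using h.1.2 x hx, Nat.eq_of_beq_eq_true h.2⟩
  | succ k ih =>
    simp only [extendsTo, List.any_eq_true, evalList_eq, Bool.and_eq_true] at h
    obtain ⟨x, -, -, -, h⟩ := h
    exact ih h

variable {V : Type*}

/-- The graph `G` is isomorphic to the graph with the neighbour lists `p`. -/
def HasPattern (G : SimpleGraph V) (p : List (List ℕ)) : Prop :=
  ∃ g : ℕ → V, Set.InjOn g (Set.Iio p.length) ∧ (∀ v, ∃ i < p.length, g i = v) ∧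
    ∀ i < p.length, ∀ j < p.length, G.Adj (g i) (g j) ↔ j ∈ p.getD i []

theorem HasPattern.of_isIso {G : SimpleGraph V} {p rows : List (List ℕ)} (h : HasPattern G rows)
    (hp : isIso p rows = true) : HasPattern G p := by
  simp only [isIso, Bool.and_eq_true] at hp
  have hlen := Nat.eq_of_beq_eq_true hp.1
  obtain ⟨σ, hσ, hσlt, hσlen⟩ := exists_of_extendsTo hp.2
  obtain ⟨g, ginj, gsurj, gadj⟩ := h
  have hmem : ∀ i < p.length, σ.getD i 0 < rows.length := fun i hi => by
    rw [← hlen, List.getD_eq_getElem _ _ (hσlen ▸ hi)]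
    exact hσlt _ (List.getElem_mem _)
  simp only [isEmbedding, List.all_eq_true, List.mem_range, Bool.and_eq_true, beq_iff_eq,
    Bool.or_eq_true, Bool.not_eq_true'] at hσ
  have hinj : Set.InjOn (fun i => g (σ.getD i 0)) (Set.Iio p.length) := by
    intro i hi j hj hij
    have := ginj (hmem i hi) (hmem j hj) hij
    rcases (hσ i hi j hj).2 with h | h
    · exact Nat.eq_of_beq_eq_true h
    · rw [this] at h
      simp at h
  refine ⟨_, hinj, ?_, fun i hi j hj => ?_⟩
  -- Surjectivity by counting: `σ` is injective between index sets of the same size.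
  · have himg : (Finset.range p.length).image (fun i => σ.getD i 0) = Finset.range rows.length := by
      apply Finset.eq_of_subset_of_card_le
      · intro x hx
        obtain ⟨i, hi, rfl⟩ := Finset.mem_image.1 hx
        exact Finset.mem_range.2 (hmem i (Finset.mem_range.1 hi))
      · rw [Finset.card_image_of_injOn, Finset.card_range, Finset.card_range, hlen]
        intro i hi j hj hij
        exact hinj (by simpa using hi) (by simpa using hj) (congrArg g hij)
    intro v
    obtain ⟨i, hi, rfl⟩ := gsurj v
    rw [← Finset.mem_range, ← himg, Finset.mem_image] at hi
    obtain ⟨j, hj, rfl⟩ := hi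
    exact ⟨j, Finset.mem_range.1 hj, rfl⟩
  · rw [gadj _ (hmem i hi) _ (hmem j hj), ← mem_iff, ← mem_iff, (hσ i hi j hj).1]

theorem HasPattern.nonempty_iso {G : SimpleGraph V} {p : List (List ℕ)} (h : HasPattern G p)
    {n : ℕ} (hn : p.length = n) (H : SimpleGraph (Fin n))
    (hH : ∀ i j : Fin n, H.Adj i j ↔ (j : ℕ) ∈ p.getD i []) : Nonempty (H ≃g G) := by
  subst hn
  obtain ⟨g, ginj, gsurj, gadj⟩ := h
  have hbij : Function.Bijective fun i : Fin p.length => g i := by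
    refine ⟨fun i j hij => Fin.ext (ginj i.2 j.2 hij), fun v => ?_⟩
    obtain ⟨i, hi, rfl⟩ := gsurj v
    exact ⟨⟨i, hi⟩, rfl⟩
  refine ⟨⟨Equiv.ofBijective _ hbij, fun {i j} => ?_⟩⟩
  exact (gadj i i.2 j j.2).trans (hH i j).symm

open Classical in
/-- The vertices `f 0, …, f (m - 1)` of `G` are distinct, the first of them have the neighbour lists
`rows`, and the degrees of the other vertices exceed two by `b` in total. -/
structure Explored [Fintype V] (G : SimpleGraph V) (rows : List (List ℕ)) (m b : ℕ) (f : ℕ → V) :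
    Prop where
  injOn : Set.InjOn f (Set.Iio m)
  length_le : rows.length ≤ m
  lt_of_mem : ∀ i < rows.length, ∀ j ∈ rows.getD i [], j < m
  adj_iff : ∀ i < rows.length, ∀ v, G.Adj (f i) v ↔ ∃ j ∈ rows.getD i [], f j = v
  sum_degree : ∑ v with ∀ i < rows.length, f i ≠ v, G.degree v =
    2 * Finset.card {v | ∀ i < rows.length, f i ≠ v} + b

namespace Explored

variable [Fintype V] {G : SimpleGraph V} {rows : List (List ℕ)} {m b : ℕ} {f : ℕ → V}

theorem adj_iff_mem (h : Explored G rows m b f) {i j : ℕ} (hi : i < rows.length) (hj : j < m) :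
    G.Adj (f i) (f j) ↔ j ∈ rows.getD i [] := by
  rw [h.adj_iff i hi]
  constructor
  · rintro ⟨l, hl, hlj⟩
    rwa [← h.injOn (h.lt_of_mem i hi l hl) hj hlj]
  · exact fun hj => ⟨j, hj, rfl⟩

/-- The listed rows are complete neighbourhoods, so a seen vertex missing from a row is truly
non-adjacent, even while most of `G` is still unknown. -/
theorem exists_isTriangular (h : Explored G rows m b f) (hr : hasRankFive rows m = true) :
    ∃ l, IsTriangular G l ∧ l.length = 5 := by
  simp only [hasRankFive, Bool.and_eq_true, List.any_eq_true, evalList_eq] at hr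
  obtain ⟨-, S, -, hS⟩ := hr
  obtain ⟨l, hl, hlS, hlp⟩ := exists_of_forces hS
  refine ⟨l.map (Prod.map f f), ⟨?_, ?_⟩, by simpa using hl⟩
  · intro q hq
    obtain ⟨p, hp, rfl⟩ := List.mem_map.1 hq
    exact (h.adj_iff _ (hlS p hp).1 _).2 ⟨p.2, (hlS p hp).2.1, rfl⟩
  · rw [List.pairwise_map]
    refine hlp.imp_of_mem fun {p q} hp hq hpq => ?_
    have hq2 := h.lt_of_mem _ (hlS q hq).1 _ (hlS q hq).2.1
    simpa [h.adj_iff_mem (hlS p hp).1 hq2] using hpq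

/-- Once every seen vertex is explored, the seen set is closed under adjacency, and connectedness
makes it everything. The sum over unexplored vertices is then empty, so no excess is left. -/
theorem hasPattern (h : Explored G rows m b f) (hm : rows.length = m) (h0 : 0 < m)
    (hconn : G.Connected) : b = 0 ∧ HasPattern G rows := by
  have hsurj : ∀ v, ∃ i < rows.length, f i = v := by
    intro v
    obtain ⟨w⟩ := hconn.preconnected (f 0) v
    have key : ∀ {u v : V} (w : G.Walk u v), (∃ i < rows.length, f i = u) →
        ∃ i < rows.length, f i = v := by
      intro u v w
      induction w with
      | nil => exact id
      | cons hadj w ih =>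
        rintro ⟨i, hi, rfl⟩
        obtain ⟨j, hj, rfl⟩ := (h.adj_iff i hi _).1 hadj
        exact ih ⟨j, hm ▸ h.lt_of_mem i hi j hj, rfl⟩
    exact key w ⟨0, hm ▸ h0, rfl⟩
  constructor
  · classical
    have := h.sum_degree
    have he : (Finset.univ.filter fun v => ∀ i < rows.length, f i ≠ v) = ∅ := by
      refine Finset.filter_eq_empty_iff.2 fun v _ hv => ?_
      obtain ⟨i, hi, hiv⟩ := hsurj v
      exact hv i hi hiv
    simp only [he] at this
    simpa using this.symm
  · exact ⟨f, hm ▸ h.injOn, hsurj, fun i hi j hj => h.adj_iff_mem hi (hm ▸ hj)⟩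

open Classical in
/-- Exploring one more vertex. -/
theorem exists_succ (h : Explored G rows m b f) (hm : rows.length < m)
    (hdeg : ∀ v, 2 ≤ G.degree v) :
    ∃ S ∈ (List.range' (rows.length + 1) (m - (rows.length + 1))).sublists, ∃ (c : ℕ) (f' : ℕ → V),
      let row := knownNeighbours rows ++ S ++ List.range' m c
      row.length = G.degree (f rows.length) ∧ row.length ≤ b + 2 ∧
        Explored G (rows ++ [row]) (m + c) (b + 2 - row.length) f' := by
  set k := rows.length with hk
  -- The neighbours of the explored vertex `f k` that have not been seen before; they receive the
  -- numbers `m`, `m + 1`, ….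
  set W : Finset V := {u | G.Adj (f k) u ∧ ∀ j < m, f j ≠ u} with hW
  set L := W.toList with hL
  have hLW : ∀ u, u ∈ L ↔ G.Adj (f k) u ∧ ∀ j < m, f j ≠ u := by simp [hL, hW]
  -- The default `f k` is reached only from `m + L.length` on, where nothing is claimed.
  set f' : ℕ → V := fun j => if j < m then f j else L.getD (j - m) (f k) with hf'
  have hf'lt : ∀ j < m, f' j = f j := fun j hj => by simp [hf', hj]
  have hf'ge : ∀ j (hj : j < L.length), f' (m + j) = L[j] := fun j hj => by simp [hf', hj]
  have hf'mem : ∀ j, m ≤ j → j < m + L.length → f' j ∈ L := by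
    intro j hj hjm
    obtain ⟨i, rfl⟩ := Nat.exists_eq_add_of_le hj
    rw [hf'ge i (by omega)]
    exact List.getElem_mem _
  have hinj : Set.InjOn f' (Set.Iio (m + L.length)) := by
    intro i hi j hj hij
    simp only [Set.mem_Iio] at hi hj
    rcases lt_or_ge i m with him | him <;> rcases lt_or_ge j m with hjm | hjm
    · rw [hf'lt i him, hf'lt j hjm] at hij
      exact h.injOn him hjm hij
    · have := ((hLW _).1 (hf'mem j hjm hj)).2 i him
      rw [← hij, hf'lt i him] at this
      exact absurd rfl this
    · have := ((hLW _).1 (hf'mem i him hi)).2 j hjm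
      rw [hij, hf'lt j hjm] at this
      exact absurd rfl this
    · obtain ⟨i, rfl⟩ := Nat.exists_eq_add_of_le him
      obtain ⟨j, rfl⟩ := Nat.exists_eq_add_of_le hjm
      rw [hf'ge i (by omega), hf'ge j (by omega)] at hij
      rw [(W.nodup_toList).getElem_inj_iff.1 hij]
  -- The neighbours already seen but not yet explored. Filtering keeps the increasing order, so this
  -- is one of the sublists enumerated by `search`.
  set S := (List.range' (k + 1) (m - (k + 1))).filter fun j => decide (G.Adj (f k) (f j)) with hS
  refine ⟨S, List.mem_sublists.2 List.filter_sublist, L.length, f', ?_⟩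
  intro row
  have hknown : ∀ j, j ∈ knownNeighbours rows ↔ j < k ∧ G.Adj (f k) (f j) := by
    intro j
    simp only [knownNeighbours, List.mem_filter, List.mem_range, mem_iff]
    refine and_congr_right fun hj => ?_
    rw [← h.adj_iff_mem hj hm, G.adj_comm]
  have hrow : ∀ j, j ∈ row ↔ j < m + L.length ∧ G.Adj (f k) (f' j) := by
    intro j
    simp only [row, List.mem_append, hknown, hS, List.mem_filter, List.mem_range'_1,
      decide_eq_true_eq]
    rcases lt_or_ge j m with hjm | hjm
    · rw [hf'lt j hjm]
      rcases lt_trichotomy j k with hjk | rfl | hjk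
      · have : j < m + L.length := by omega
        simp [hjk, this, Nat.not_lt.2 hjk.le]
        omega
      · simp
        omega
      · have h1 : j < m + L.length := by omega
        have h2 : j < k + 1 + (m - (k + 1)) := by omega
        simp [h1, h2, Nat.succ_le_of_lt hjk, Nat.not_le.2 hjm]
    · have h1 : ¬ j < k := by omega
      have h2 : ¬ j < k + 1 + (m - (k + 1)) := by omega
      simp only [h1, h2, false_and, and_false, false_or, hjm, true_and, iff_self_and]
      exact fun hj => ((hLW _).1 (hf'mem j hjm hj)).1
  have hrowadj : ∀ v, G.Adj (f k) v ↔ ∃ j ∈ row, f' j = v := by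
    intro v
    constructor
    · intro hv
      by_cases hj : ∃ j < m, f j = v
      · obtain ⟨j, hj, rfl⟩ := hj
        exact ⟨j, (hrow j).2 ⟨by omega, by rwa [hf'lt j hj]⟩, hf'lt j hj⟩
      · push Not at hj
        obtain ⟨i, hi, rfl⟩ := List.mem_iff_getElem.1 ((hLW v).2 ⟨hv, hj⟩)
        exact ⟨m + i, (hrow _).2 ⟨by omega, by rwa [hf'ge i hi]⟩, hf'ge i hi⟩
    · rintro ⟨j, hj, rfl⟩
      exact ((hrow j).1 hj).2
  have hnodup : row.Nodup := by
    refine List.Nodup.append (List.Nodup.append (List.nodup_range.filter _)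
      ((List.nodup_range' (step := 1)).filter _) ?_) List.nodup_range' ?_
    · intro j hj hj'
      have h1 := ((hknown j).1 hj).1
      have h2 := List.mem_range'_1.1 (List.mem_of_mem_filter hj')
      omega
    · intro j hj hj'
      have h2 := List.mem_range'_1.1 hj'
      rcases List.mem_append.1 hj with hj | hj
      · have h1 := ((hknown j).1 hj).1
        omega
      · have h1 := List.mem_range'_1.1 (List.mem_of_mem_filter hj)
        omega
  have hlen : row.length = G.degree (f k) := by
    rw [← List.toFinset_card_of_nodup hnodup, ← G.card_neighborFinset_eq_degree,
      ← Finset.card_image_of_injOn (f := f') (s := row.toFinset)]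
    · congr 1
      ext v
      simp [hrowadj]
    · intro i hi j hj hij
      exact hinj ((hrow i).1 (by simpa using hi)).1 ((hrow j).1 (by simpa using hj)).1 hij
  have herase : (Finset.univ.filter fun v => ∀ i < (rows ++ [row]).length, f' i ≠ v) =
      (Finset.univ.filter fun v => ∀ i < k, f i ≠ v).erase (f k) := by
    ext v
    simp only [List.length_append, List.length_singleton, Finset.mem_filter, Finset.mem_univ,
      true_and, Finset.mem_erase, ← hk]
    constructor
    · intro hv
      exact ⟨fun hvk => hv k (by omega) (by rw [hf'lt k hm, hvk]),
        fun i hi => hf'lt i (by omega) ▸ hv i (by omega)⟩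
    · rintro ⟨hv, hv'⟩ i hi
      rw [hf'lt i (by omega)]
      rcases Nat.lt_succ_iff_lt_or_eq.1 hi with hi | rfl
      · exact hv' i hi
      · exact hv.symm
  have hkmem : f k ∈ Finset.univ.filter fun v => ∀ i < k, f i ≠ v := by
    simp only [Finset.mem_filter, Finset.mem_univ, true_and]
    intro i hi hik
    have := h.injOn (show i < m by omega) hm hik
    omega
  have hsum := h.sum_degree
  rw [← hk, ← Finset.add_sum_erase _ _ hkmem, ← Finset.card_erase_add_one hkmem] at hsum
  -- The other unexplored vertices have degree at least 2, so `f k` alone cannot use more than the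
  -- whole excess `b`. This also makes the truncated subtraction `b + 2 - row.length` exact.
  have hge := Finset.card_nsmul_le_sum _ (fun v => G.degree v) 2 fun v
    (_ : v ∈ (Finset.univ.filter fun v => ∀ i < k, f i ≠ v).erase (f k)) => hdeg v
  simp only [smul_eq_mul] at hge
  refine ⟨hlen, by omega, ?_⟩
  have hget : ∀ i < k, (rows ++ [row]).getD i [] = rows.getD i [] := fun i hi =>
    List.getD_append _ _ _ _ hi
  have hgetk : (rows ++ [row]).getD k [] = row := by simp [hk]
  refine ⟨hinj, by simp; omega, ?_, ?_, ?_⟩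
  · intro i hi j hj
    rcases Nat.lt_succ_iff_lt_or_eq.1 (show i < k + 1 by simpa using hi) with hi | rfl
    · rw [hget i hi] at hj
      have := h.lt_of_mem i hi j hj
      omega
    · rw [hgetk] at hj
      exact ((hrow j).1 hj).1
  · intro i hi v
    rcases Nat.lt_succ_iff_lt_or_eq.1 (show i < k + 1 by simpa using hi) with hi | rfl
    · rw [hget i hi, hf'lt i (by omega), h.adj_iff i hi]
      refine exists_congr fun j => and_congr_right fun hj => ?_
      rw [hf'lt j (h.lt_of_mem i hi j hj)]
    · rw [hgetk, hf'lt k hm, hrowadj]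
  · rw [herase, hlen]
    omega

/-- The actual graph selects one branch of the search tree. Following it, `hrank` excludes the
closure by a triangular array, so the branch must end at a fully explored graph, which matches a
pattern. -/
theorem exists_hasPattern_of_search (hconn : G.Connected)
    (hdeg : ∀ [DecidableRel G.Adj] v, 2 ≤ G.degree v)
    (hrank : ∀ l, IsTriangular G l → l.length < 5) {fuel : ℕ} (h0 : 0 < m)
    (h : Explored G rows m b f) (hs : search fuel rows m b = true) :
    ∃ p ∈ patterns, HasPattern G p := by
  classical
  induction fuel generalizing rows m b f with
  | zero => simp [search] at hs
  | succ fuel ih =>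
    rw [search, Bool.or_eq_true] at hs
    rcases hs with hs | hs
    · obtain ⟨l, hl, hl5⟩ := h.exists_isTriangular hs
      have := hrank l hl
      omega
    · by_cases hm : rows.length = m
      · rw [hm, Nat.beq_refl, cond_true, Bool.or_eq_true, List.any_eq_true] at hs
        obtain ⟨rfl, hp⟩ := h.hasPattern hm h0 hconn
        rcases hs with hs | ⟨p, hp', hs⟩
        · simp at hs
        · exact ⟨p, hp', hp.of_isIso hs⟩
      · have hmb : Nat.beq rows.length m = false := by
          rw [Bool.eq_false_iff]
          exact fun h => hm (Nat.eq_of_beq_eq_true h)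
        obtain ⟨S, hS, c, f', hlen, hle, h'⟩ := h.exists_succ
          (lt_of_le_of_ne h.length_le hm) hdeg
        have h2 := hdeg (f rows.length)
        rw [← hlen] at h2
        simp only [hmb, cond_false, List.all_eq_true, evalList_eq, evalNat_eq] at hs
        have hc : c ∈ List.range (b + 3) := by
          rw [List.mem_range]
          simp only [List.length_append, List.length_range'] at hle
          omega
        have := hs S hS c hc
        rw [Bool.or_eq_true, Bool.or_eq_true] at this
        rcases this with (h3 | h3) | h3
        · have := Nat.le_of_ble_eq_true h3
          omega
        · have := Nat.le_of_ble_eq_true h3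
          omega
        · exact ih (by omega) h' h3

end Explored

open Classical in
/-- A connected graph of minimum degree at least two with one more edge than vertices and without
a triangular array of five adjacencies is one of the ten listed graphs. -/
theorem exists_hasPattern [Fintype V] {G : SimpleGraph V} (hconn : G.Connected)
    (hdeg : ∀ v, 2 ≤ G.degree v) (hedges : G.edgeFinset.card = Fintype.card V + 1)
    (hrank : ∀ l, IsTriangular G l → l.length < 5) : ∃ p ∈ patterns, HasPattern G p := by
  have hsum := G.sum_degrees_eq_twice_card_edges
  -- If all degrees were at most 2, their sum could not reach 2|V| + 2.
  obtain ⟨v, hv⟩ : ∃ v, 3 ≤ G.degree v := by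
    by_contra! hlt
    have := Finset.sum_le_card_nsmul Finset.univ (fun v => G.degree v) 2
      fun v _ => Nat.le_of_lt_succ (hlt v)
    simp only [Finset.card_univ, smul_eq_mul] at this
    omega
  -- Nothing is explored yet, and the total excess is 2|E| - 2|V| = 2.
  have h0 : Explored G [] 1 2 fun _ => v := by
    refine ⟨?_, by simp, by simp, by simp, ?_⟩
    · intro i hi j hj _
      simp only [Set.mem_Iio] at hi hj
      omega
    · simp [hsum, hedges]
      ring
  obtain ⟨S, hS, c, f, hlen, hle, h⟩ := h0.exists_succ (by simp) hdeg
  simp only [List.length_nil, zero_add, Nat.sub_self, List.range'_zero, List.sublists_nil,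
    List.mem_singleton] at hS
  subst hS
  have hk : knownNeighbours [] = [] := rfl
  simp only [hk, List.nil_append, List.length_range'] at hlen hle h
  -- All neighbours of the first vertex are new, so `c` is its degree: at least 3 by choice, at most
  -- 2 + 2 by the excess.
  have hc : c = 3 ∨ c = 4 := by omega
  have hs := search_three_and_four
  rw [Bool.and_eq_true] at hs
  have hdeg' : ∀ [DecidableRel G.Adj] v, 2 ≤ G.degree v := by
    intro _ v
    convert hdeg v
  rcases hc with rfl | rfl
  · exact h.exists_hasPattern_of_search hconn hdeg' hrank (by omega) hs.1
  · exact h.exists_hasPattern_of_search hconn hdeg' hrank (by omega) hs.2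

end Unfolding

/-! ### Row rank over the quaternions and elimination. -/

open Module Submodule

variable {m n : Type*} [Fintype n]

/-- The dimension of the left row space of a quaternion matrix. -/
def rowSpaceDim (A : Matrix m n ℍ[ℝ]) : ℕ :=
  finrank ℍ[ℝ] (span ℍ[ℝ] (Set.range fun i => A i))

/-- Over a division ring some independent subfamily of the rows spans the row space, and no
independent subfamily can exceed its dimension. -/
theorem leftRowRank_eq_rowSpaceDim [Fintype m] (A : Matrix m n ℍ[ℝ]) :
    leftRowRank A = rowSpaceDim A := by
  classical
  refine IsGreatest.csSup_eq ⟨?_, ?_⟩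
  · obtain ⟨κ, a, ha, hspan, hli⟩ := exists_linearIndependent' ℍ[ℝ] (fun i => A i)
    have : Finite κ := Finite.of_injective a ha
    have := Fintype.ofFinite κ
    refine ⟨Finset.univ.map ⟨a, ha⟩, ?_, ?_⟩
    · let f : (Finset.univ.map ⟨a, ha⟩ : Finset m) → κ := fun i =>
        (Finset.mem_map.1 i.2).choose
      have hf : ∀ i, a (f i) = i := fun i => (Finset.mem_map.1 i.2).choose_spec.2
      have := hli.comp f fun i j hij => by
        rw [Subtype.ext_iff, ← hf i, ← hf j, hij]
      have hA : (((fun i => A i) ∘ a) ∘ f) =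
          fun i : (Finset.univ.map ⟨a, ha⟩ : Finset m) => A i := by
        funext i
        simp [hf]
      rwa [hA] at this
    · rw [Finset.card_map, Finset.card_univ, rowSpaceDim, ← hspan, finrank_span_eq_card hli]
  · rintro k ⟨s, hs, rfl⟩
    rw [← Fintype.card_coe, ← finrank_span_eq_card hs]
    exact finrank_mono (span_mono (Set.range_subset_iff.2 fun i => ⟨i, rfl⟩))

theorem rowSpaceDim_eq_zero_iff {A : Matrix m n ℍ[ℝ]} : rowSpaceDim A = 0 ↔ A = 0 := by
  rw [rowSpaceDim, finrank_eq_zero, span_eq_bot]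
  constructor
  · intro h
    funext i
    exact h _ ⟨i, rfl⟩
  · rintro rfl _ ⟨i, rfl⟩
    rfl

theorem rowSpaceDim_reindex {m' : Type*} [Fintype m'] [Fintype m] (e : m' ≃ m) (A : Matrix m m ℍ[ℝ]) :
    rowSpaceDim (Matrix.of fun i j => A (e i) (e j)) = rowSpaceDim A := by
  rw [rowSpaceDim, rowSpaceDim,
    ← LinearEquiv.finrank_map_eq (LinearEquiv.funCongrLeft ℍ[ℝ] ℍ[ℝ] e), map_span,
    ← Set.range_comp, ← e.surjective.range_comp]
  rfl

/-- Wedderburn's rank reduction: eliminating with a nonzero entry lowers the rank by one. -/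
theorem rowSpaceDim_eq_add_one {A B : Matrix m n ℍ[ℝ]} (a : m) (b : n) (hab : A a b ≠ 0)
    (hB : ∀ i j, B i j = A i j - A i b * (A a b)⁻¹ * A a j) :
    rowSpaceDim A = rowSpaceDim B + 1 := by
  have hrow : ∀ i, B i = A i - (A i b * (A a b)⁻¹) • A a := by
    intro i
    funext j
    exact hB i j
  set S := span ℍ[ℝ] (Set.range fun i => B i) with hS
  have hsup : span ℍ[ℝ] (Set.range fun i => A i) = S ⊔ span ℍ[ℝ] {A a} := by
    apply le_antisymm
    · rw [span_le]
      rintro _ ⟨i, rfl⟩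
      have : A i = B i + (A i b * (A a b)⁻¹) • A a := by rw [hrow, sub_add_cancel]
      simp only [SetLike.mem_coe]
      rw [this]
      exact add_mem_sup (subset_span ⟨i, rfl⟩) (smul_mem _ _ (mem_span_singleton_self _))
    · rw [sup_le_iff, span_le, span_singleton_le_iff_mem]
      refine ⟨?_, subset_span ⟨a, rfl⟩⟩
      rintro _ ⟨i, rfl⟩
      simp only [SetLike.mem_coe, hrow]
      exact sub_mem (subset_span ⟨i, rfl⟩) (smul_mem _ _ (subset_span ⟨a, rfl⟩))
  -- Column `b` separates the two summands: all rows of `B` vanish there, while the pivot row does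
  -- not. Hence the sum is direct.
  have hker : S ≤ LinearMap.ker (LinearMap.proj b : (n → ℍ[ℝ]) →ₗ[ℍ[ℝ]] ℍ[ℝ]) := by
    rw [hS, span_le]
    rintro _ ⟨i, rfl⟩
    simp [hB, hab]
  have hne : A a ≠ 0 := fun h => hab (by simp [h])
  have hinf : S ⊓ span ℍ[ℝ] {A a} = ⊥ := by
    rw [eq_bot_iff]
    rintro x ⟨hx, hxa⟩
    obtain ⟨c, rfl⟩ := mem_span_singleton.1 hxa
    have := hker hx
    simp [hab] at this
    simp [this]
  have := finrank_sup_add_finrank_inf_eq S (span ℍ[ℝ] {A a})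
  rwa [hinf, finrank_bot, finrank_span_singleton hne, ← hsup] at this

/-- Eliminating with a pair of nonzero entries in symmetric positions. -/
theorem rowSpaceDim_eq_add_two [Fintype m] {A B : Matrix m m ℍ[ℝ]} (a b : m) (hab : A a b ≠ 0)
    (hba : A b a ≠ 0) (ha : A a a = 0) (hb : A b b = 0)
    (hB : ∀ i j, B i j = A i j - A i b * (A a b)⁻¹ * A a j - A i a * (A b a)⁻¹ * A b j) :
    rowSpaceDim A = rowSpaceDim B + 2 := by
  -- As both diagonal entries vanish, the first elimination changes neither column `a` nor row `b`,
  -- so the second one can use the original entries.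
  rw [rowSpaceDim_eq_add_one (B := Matrix.of fun i j => A i j - A i b * (A a b)⁻¹ * A a j) a b hab
    fun i j => rfl, rowSpaceDim_eq_add_one (A := Matrix.of _) (B := B) b a]
  · simp [ha, hba]
  · intro i j
    simp [ha, hb, hB]

/-- Restrict the row space successively by the vanishing of the coordinates `p.2`, starting from the
end of the list. Row `p.1` satisfies the later conditions but not its own, so each condition lowers
the dimension. -/
theorem IsTriangular.length_le {V : Type*} [Fintype V] {G : SimpleGraph V} {A : Matrix V V ℍ[ℝ]}
    (hA : ∀ u v, A u v ≠ 0 ↔ G.Adj u v) {l : List (V × V)} (hl : IsTriangular G l) :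
    l.length ≤ rowSpaceDim A := by
  set W := span ℍ[ℝ] (Set.range fun i => A i) with hW
  suffices h : l.length + finrank ℍ[ℝ] ↥(W ⊓ ⨅ p ∈ l,
      LinearMap.ker (LinearMap.proj p.2 : (V → ℍ[ℝ]) →ₗ[ℍ[ℝ]] ℍ[ℝ])) ≤ finrank ℍ[ℝ] W from
    le_trans (Nat.le_add_right _ _) h
  obtain ⟨hadj, hpair⟩ := hl
  induction l with
  | nil => simpa using finrank_mono inf_le_left
  | cons p l ih =>
    rw [List.pairwise_cons] at hpair
    have ih := ih (fun q hq => hadj q (List.mem_cons_of_mem _ hq)) hpair.2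
    set K := W ⊓ ⨅ p ∈ l, LinearMap.ker (LinearMap.proj p.2 : (V → ℍ[ℝ]) →ₗ[ℍ[ℝ]] ℍ[ℝ])
    have hmem : A p.1 ∈ K := by
      refine ⟨subset_span ⟨p.1, rfl⟩, ?_⟩
      simp only [SetLike.mem_coe, mem_iInf, LinearMap.mem_ker, LinearMap.proj_apply]
      intro q hq
      by_contra h
      exact hpair.1 q hq ((hA _ _).1 h)
    have hlt : W ⊓ ⨅ q ∈ p :: l,
        LinearMap.ker (LinearMap.proj q.2 : (V → ℍ[ℝ]) →ₗ[ℍ[ℝ]] ℍ[ℝ]) < K := by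
      refine lt_of_le_of_ne (inf_le_inf_left _ (biInf_mono fun q hq => List.mem_cons_of_mem _ hq)) ?_
      intro h
      rw [← h] at hmem
      have h2 := hmem.2
      simp only [SetLike.mem_coe, mem_iInf, LinearMap.mem_ker, LinearMap.proj_apply] at h2
      exact (hA _ _).2 (hadj p List.mem_cons_self) (h2 p List.mem_cons_self)
    have := finrank_lt_finrank_of_lt hlt
    rw [List.length_cons]
    omega

/-! ### Conjugates and inverses of the gains. -/

namespace UQGainGraph

variable {V : Type*} (Γ : UQGainGraph V)

theorem adjMatrix_ne_zero_iff {u v : V} : Γ.adjMatrix u v ≠ 0 ↔ Γ.graph.Adj u v := by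
  unfold adjMatrix
  split
  · rename_i h
    simp only [h, iff_true]
    intro h0
    have := norm_eq_of_mem_sphere (Γ.gain h)
    rw [h0] at this
    simp at this
  · rename_i h
    simp [h]

theorem adjMatrix_symm (u v : V) : Γ.adjMatrix v u = (Γ.adjMatrix u v)⁻¹ := by
  unfold adjMatrix
  by_cases h : Γ.graph.Adj u v
  · rw [dif_pos h, dif_pos h.symm, Γ.gain_symm h]
    rfl
  · rw [dif_neg h, dif_neg fun h' => h h'.symm, inv_zero]

/-- For a unit quaternion the conjugate is the inverse; for non-edges both sides are 0. This turns
the inverses left by elimination into conjugates, from which real parts arise. -/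
theorem star_adjMatrix (u v : V) : star (Γ.adjMatrix u v) = (Γ.adjMatrix u v)⁻¹ := by
  unfold adjMatrix
  split
  · rename_i h
    rw [Quaternion.inv_def, Quaternion.normSq_eq_norm_mul_self, norm_eq_of_mem_sphere (Γ.gain h)]
    simp
  · simp

end UQGainGraph

/-! ### Elimination in the eleven adjacency matrices. -/

/-- The adjacency matrix of a gain graph on `G1`, the edges having the gains `a, b, c, d, e, f` in the order
in which they are listed in `G1`. -/
def adj1 (a b c d e f : ℍ[ℝ]) : Matrix (Fin 5) (Fin 5) ℍ[ℝ] :=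
    !![0, d⁻¹, 0, 0, e;
      d, 0, c⁻¹, a, f⁻¹;
      0, c, 0, b⁻¹, 0;
      0, a⁻¹, b, 0, 0;
      e⁻¹, f, 0, 0, 0]

/-- Eliminating the edges opposite to `v₁` folds each triangle into the diagonal entry at `v₁`. -/
theorem rowSpaceDim_adj1 {a b c d e f : ℍ[ℝ]} (hb : b ≠ 0) (he : e ≠ 0) :
    rowSpaceDim (adj1 a b c d e f) = rowSpaceDim
      !![0, 0, 0, 0, 0;
      0, -c⁻¹ * b⁻¹ * a⁻¹ - a * b * c - f⁻¹ * e⁻¹ * d⁻¹ - d * e * f, 0, 0, 0;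
      0, 0, 0, 0, 0;
      0, 0, 0, 0, 0;
      0, 0, 0, 0, 0] + 4 := by
  unfold adj1
  rw [rowSpaceDim_eq_add_two (B :=
      !![0, d⁻¹, 0, 0, e;
      d, -c⁻¹ * b⁻¹ * a⁻¹ - a * b * c, 0, 0, f⁻¹;
      0, 0, 0, 0, 0;
      0, 0, 0, 0, 0;
      e⁻¹, f, 0, 0, 0]) 3 2,
    rowSpaceDim_eq_add_two (B :=
      !![0, 0, 0, 0, 0;
      0, -c⁻¹ * b⁻¹ * a⁻¹ - a * b * c - f⁻¹ * e⁻¹ * d⁻¹ - d * e * f, 0, 0, 0;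
      0, 0, 0, 0, 0;
      0, 0, 0, 0, 0;
      0, 0, 0, 0, 0]) 0 4]
  · simp [*]
  · simp [*]
  · simp
  · simp
  · intro i j
    fin_cases i <;> fin_cases j <;> simp [mul_assoc, *]
  · simp [*]
  · simp [*]
  · simp
  · simp
  · intro i j
    fin_cases i <;> fin_cases j <;> simp [mul_assoc, *]

/-- The adjacency matrix of a gain graph on `G2`, the edges having the gains `a, b, c, d, e, f, g` in the order
in which they are listed in `G2`. -/
def adj2 (a b c d e f g : ℍ[ℝ]) : Matrix (Fin 6) (Fin 6) ℍ[ℝ] :=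
    !![0, 0, 0, g, 0, f⁻¹;
      0, 0, a, c⁻¹, 0, 0;
      0, a⁻¹, 0, b, 0, 0;
      g⁻¹, c, b⁻¹, 0, d, 0;
      0, 0, 0, d⁻¹, 0, e;
      f, 0, 0, 0, e⁻¹, 0]

/-- The edge 12 folds the triangle into the diagonal at `v₃`; the edge 45 folds the path 3,4,5,6
onto the edge 36. -/
theorem rowSpaceDim_adj2 {a b c d e f g : ℍ[ℝ]} (ha : a ≠ 0) (he : e ≠ 0) :
    rowSpaceDim (adj2 a b c d e f g) = rowSpaceDim
      !![0, 0, 0, g - f⁻¹ * e⁻¹ * d⁻¹, 0, 0;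
      0, 0, 0, 0, 0, 0;
      0, 0, 0, 0, 0, 0;
      g⁻¹ - d * e * f, 0, 0, -b⁻¹ * a⁻¹ * c⁻¹ - c * a * b, 0, 0;
      0, 0, 0, 0, 0, 0;
      0, 0, 0, 0, 0, 0] + 4 := by
  unfold adj2
  rw [rowSpaceDim_eq_add_two (B :=
      !![0, 0, 0, g, 0, f⁻¹;
      0, 0, 0, 0, 0, 0;
      0, 0, 0, 0, 0, 0;
      g⁻¹, 0, 0, -b⁻¹ * a⁻¹ * c⁻¹ - c * a * b, d, 0;
      0, 0, 0, d⁻¹, 0, e;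
      f, 0, 0, 0, e⁻¹, 0]) 1 2,
    rowSpaceDim_eq_add_two (B :=
      !![0, 0, 0, g - f⁻¹ * e⁻¹ * d⁻¹, 0, 0;
      0, 0, 0, 0, 0, 0;
      0, 0, 0, 0, 0, 0;
      g⁻¹ - d * e * f, 0, 0, -b⁻¹ * a⁻¹ * c⁻¹ - c * a * b, 0, 0;
      0, 0, 0, 0, 0, 0;
      0, 0, 0, 0, 0, 0]) 4 5]
  · simp [*]
  · simp [*]
  · simp
  · simp
  · intro i j
    fin_cases i <;> fin_cases j <;> simp [mul_assoc, *]
  · simp [*]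
  · simp [*]
  · simp
  · simp
  · intro i j
    fin_cases i <;> fin_cases j <;> simp [mul_assoc, *]

/-- The adjacency matrix of a gain graph on `G3`, the edges having the gains `a, b, c, d, e, f, g, h` in the order
in which they are listed in `G3`. -/
def adj3 (a b c d e f g h : ℍ[ℝ]) : Matrix (Fin 7) (Fin 7) ℍ[ℝ] :=
    !![0, 0, 0, 0, h, 0, g⁻¹;
      0, 0, a, d⁻¹, 0, 0, 0;
      0, a⁻¹, 0, 0, b, 0, 0;
      0, d, 0, 0, c⁻¹, 0, 0;
      h⁻¹, 0, b⁻¹, c, 0, e, 0;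
      0, 0, 0, 0, e⁻¹, 0, f;
      g, 0, 0, 0, 0, f⁻¹, 0]

/-- Each quadrangle loses one edge avoiding `v₄`, and its three-edge path is folded onto its
remaining edge. -/
theorem rowSpaceDim_adj3 {a b c d e f g h : ℍ[ℝ]} (ha : a ≠ 0) (hf : f ≠ 0) :
    rowSpaceDim (adj3 a b c d e f g h) = rowSpaceDim
      !![0, 0, 0, 0, h - g⁻¹ * f⁻¹ * e⁻¹, 0, 0;
      0, 0, 0, 0, 0, 0, 0;
      0, 0, 0, 0, 0, 0, 0;
      0, 0, 0, 0, c⁻¹ - d * a * b, 0, 0;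
      h⁻¹ - e * f * g, 0, 0, c - b⁻¹ * a⁻¹ * d⁻¹, 0, 0, 0;
      0, 0, 0, 0, 0, 0, 0;
      0, 0, 0, 0, 0, 0, 0] + 4 := by
  unfold adj3
  rw [rowSpaceDim_eq_add_two (B :=
      !![0, 0, 0, 0, h, 0, g⁻¹;
      0, 0, 0, 0, 0, 0, 0;
      0, 0, 0, 0, 0, 0, 0;
      0, 0, 0, 0, c⁻¹ - d * a * b, 0, 0;
      h⁻¹, 0, 0, c - b⁻¹ * a⁻¹ * d⁻¹, 0, e, 0;
      0, 0, 0, 0, e⁻¹, 0, f;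
      g, 0, 0, 0, 0, f⁻¹, 0]) 1 2,
    rowSpaceDim_eq_add_two (B :=
      !![0, 0, 0, 0, h - g⁻¹ * f⁻¹ * e⁻¹, 0, 0;
      0, 0, 0, 0, 0, 0, 0;
      0, 0, 0, 0, 0, 0, 0;
      0, 0, 0, 0, c⁻¹ - d * a * b, 0, 0;
      h⁻¹ - e * f * g, 0, 0, c - b⁻¹ * a⁻¹ * d⁻¹, 0, 0, 0;
      0, 0, 0, 0, 0, 0, 0;
      0, 0, 0, 0, 0, 0, 0]) 5 6]
  · simp [*]
  · simp [*]
  · simp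
  · simp
  · intro i j
    fin_cases i <;> fin_cases j <;> simp [mul_assoc, *]
  · simp [*]
  · simp [*]
  · simp
  · simp
  · intro i j
    fin_cases i <;> fin_cases j <;> simp [mul_assoc, *]

/-- The adjacency matrix of a gain graph on `G4`, the edges having the gains `a, b, c, d, e, f, g` in the order
in which they are listed in `G4`. -/
def adj4 (a b c d e f g : ℍ[ℝ]) : Matrix (Fin 6) (Fin 6) ℍ[ℝ] :=
    !![0, 0, 0, 0, d⁻¹, e;
      0, 0, c⁻¹, a, g, 0;
      0, c, 0, b⁻¹, 0, 0;
      0, a⁻¹, b, 0, 0, 0;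
      d, g⁻¹, 0, 0, 0, f⁻¹;
      e⁻¹, 0, 0, 0, f, 0]

/-- Both triangles fold into diagonal entries at `v₁` and `v₄`, and the joining edge survives
untouched. -/
theorem rowSpaceDim_adj4 {a b c d e f g : ℍ[ℝ]} (hb : b ≠ 0) (he : e ≠ 0) :
    rowSpaceDim (adj4 a b c d e f g) = rowSpaceDim
      !![0, 0, 0, 0, 0, 0;
      0, -c⁻¹ * b⁻¹ * a⁻¹ - a * b * c, 0, 0, g, 0;
      0, 0, 0, 0, 0, 0;
      0, 0, 0, 0, 0, 0;
      0, g⁻¹, 0, 0, -f⁻¹ * e⁻¹ * d⁻¹ - d * e * f, 0;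
      0, 0, 0, 0, 0, 0] + 4 := by
  unfold adj4
  rw [rowSpaceDim_eq_add_two (B :=
      !![0, 0, 0, 0, d⁻¹, e;
      0, -c⁻¹ * b⁻¹ * a⁻¹ - a * b * c, 0, 0, g, 0;
      0, 0, 0, 0, 0, 0;
      0, 0, 0, 0, 0, 0;
      d, g⁻¹, 0, 0, 0, f⁻¹;
      e⁻¹, 0, 0, 0, f, 0]) 3 2,
    rowSpaceDim_eq_add_two (B :=
      !![0, 0, 0, 0, 0, 0;
      0, -c⁻¹ * b⁻¹ * a⁻¹ - a * b * c, 0, 0, g, 0;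
      0, 0, 0, 0, 0, 0;
      0, 0, 0, 0, 0, 0;
      0, g⁻¹, 0, 0, -f⁻¹ * e⁻¹ * d⁻¹ - d * e * f, 0;
      0, 0, 0, 0, 0, 0]) 0 5]
  · simp [*]
  · simp [*]
  · simp
  · simp
  · intro i j
    fin_cases i <;> fin_cases j <;> simp [mul_assoc, *]
  · simp [*]
  · simp [*]
  · simp
  · simp
  · intro i j
    fin_cases i <;> fin_cases j <;> simp [mul_assoc, *]

/-- The adjacency matrix of a gain graph on `G5`, the edges having the gains `a, b, c, d, e` in the order
in which they are listed in `G5`. -/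
def adj5 (a b c d e : ℍ[ℝ]) : Matrix (Fin 4) (Fin 4) ℍ[ℝ] :=
    !![0, d, e⁻¹, c⁻¹;
      d⁻¹, 0, a, 0;
      e, a⁻¹, 0, b;
      c, 0, b⁻¹, 0]

theorem rowSpaceDim_adj5 {a b c d e : ℍ[ℝ]} (ha : a ≠ 0) :
    rowSpaceDim (adj5 a b c d e) = rowSpaceDim
      !![-e⁻¹ * a⁻¹ * d⁻¹ - d * a * e, 0, 0, c⁻¹ - d * a * b;
      0, 0, 0, 0;
      0, 0, 0, 0;
      c - b⁻¹ * a⁻¹ * d⁻¹, 0, 0, 0] + 2 := by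
  unfold adj5
  rw [rowSpaceDim_eq_add_two (B :=
      !![-e⁻¹ * a⁻¹ * d⁻¹ - d * a * e, 0, 0, c⁻¹ - d * a * b;
      0, 0, 0, 0;
      0, 0, 0, 0;
      c - b⁻¹ * a⁻¹ * d⁻¹, 0, 0, 0]) 1 2]
  · simp [*]
  · simp [*]
  · simp
  · simp
  · intro i j
    fin_cases i <;> fin_cases j <;> simp [mul_assoc, *]

/-- The adjacency matrix of a gain graph on `G6`, the edges having the gains `a, b, c, d, e, f` in the order
in which they are listed in `G6`. -/
def adj6 (a b c d e f : ℍ[ℝ]) : Matrix (Fin 5) (Fin 5) ℍ[ℝ] :=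
    !![0, e, f⁻¹, 0, d⁻¹;
      e⁻¹, 0, a, 0, 0;
      f, a⁻¹, 0, b, 0;
      0, 0, b⁻¹, 0, c;
      d, 0, 0, c⁻¹, 0]

/-- The edge 34 folds the path 2,3,4,5 onto the chord, whose entry becomes `f - b * c * d`. The edge
12 then folds the resulting triangle into the diagonal at `v₅`. -/
theorem rowSpaceDim_adj6 {a b c d e f : ℍ[ℝ]} (ha : a ≠ 0) (hc : c ≠ 0) :
    rowSpaceDim (adj6 a b c d e f) = rowSpaceDim
      !![-((f⁻¹ - d⁻¹ * c⁻¹ * b⁻¹) * a⁻¹ * e⁻¹) - e * a * (f - b * c * d), 0, 0, 0, 0;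
      0, 0, 0, 0, 0;
      0, 0, 0, 0, 0;
      0, 0, 0, 0, 0;
      0, 0, 0, 0, 0] + 4 := by
  unfold adj6
  rw [rowSpaceDim_eq_add_two (B :=
      !![0, e, f⁻¹ - d⁻¹ * c⁻¹ * b⁻¹, 0, 0;
      e⁻¹, 0, a, 0, 0;
      f - b * c * d, a⁻¹, 0, 0, 0;
      0, 0, 0, 0, 0;
      0, 0, 0, 0, 0]) 3 4,
    rowSpaceDim_eq_add_two (B :=
      !![-((f⁻¹ - d⁻¹ * c⁻¹ * b⁻¹) * a⁻¹ * e⁻¹) - e * a * (f - b * c * d), 0, 0, 0, 0;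
      0, 0, 0, 0, 0;
      0, 0, 0, 0, 0;
      0, 0, 0, 0, 0;
      0, 0, 0, 0, 0]) 1 2]
  · simp [*]
  · simp [*]
  · simp
  · simp
  · intro i j
    fin_cases i <;> fin_cases j <;> simp [mul_assoc, *]
  · simp [*]
  · simp [*]
  · simp
  · simp
  · intro i j
    fin_cases i <;> fin_cases j <;> simp [mul_assoc, *]

/-- The adjacency matrix of a gain graph on `G7`, the edges having the gains `a, b, c, d, e, f, g` in the order
in which they are listed in `G7`. -/
def adj7 (a b c d e f g : ℍ[ℝ]) : Matrix (Fin 6) (Fin 6) ℍ[ℝ] :=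
    !![0, f, g⁻¹, 0, 0, e⁻¹;
      f⁻¹, 0, a, 0, 0, 0;
      g, a⁻¹, 0, b, 0, 0;
      0, 0, b⁻¹, 0, c, 0;
      0, 0, 0, c⁻¹, 0, d;
      e, 0, 0, 0, d⁻¹, 0]

theorem rowSpaceDim_adj7 {a b c d e f g : ℍ[ℝ]} (ha : a ≠ 0) (hd : d ≠ 0) :
    rowSpaceDim (adj7 a b c d e f g) = rowSpaceDim
      !![-g⁻¹ * a⁻¹ * f⁻¹ - f * a * g, 0, 0, -f * a * b - e⁻¹ * d⁻¹ * c⁻¹, 0, 0;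
      0, 0, 0, 0, 0, 0;
      0, 0, 0, 0, 0, 0;
      -b⁻¹ * a⁻¹ * f⁻¹ - c * d * e, 0, 0, 0, 0, 0;
      0, 0, 0, 0, 0, 0;
      0, 0, 0, 0, 0, 0] + 4 := by
  unfold adj7
  rw [rowSpaceDim_eq_add_two (B :=
      !![-g⁻¹ * a⁻¹ * f⁻¹ - f * a * g, 0, 0, -f * a * b, 0, e⁻¹;
      0, 0, 0, 0, 0, 0;
      0, 0, 0, 0, 0, 0;
      -b⁻¹ * a⁻¹ * f⁻¹, 0, 0, 0, c, 0;
      0, 0, 0, c⁻¹, 0, d;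
      e, 0, 0, 0, d⁻¹, 0]) 1 2,
    rowSpaceDim_eq_add_two (B :=
      !![-g⁻¹ * a⁻¹ * f⁻¹ - f * a * g, 0, 0, -f * a * b - e⁻¹ * d⁻¹ * c⁻¹, 0, 0;
      0, 0, 0, 0, 0, 0;
      0, 0, 0, 0, 0, 0;
      -b⁻¹ * a⁻¹ * f⁻¹ - c * d * e, 0, 0, 0, 0, 0;
      0, 0, 0, 0, 0, 0;
      0, 0, 0, 0, 0, 0]) 4 5]
  · simp [*]
  · simp [*]
  · simp
  · simp
  · intro i j
    fin_cases i <;> fin_cases j <;> simp [mul_assoc, *]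
  · simp [*]
  · simp [*]
  · simp
  · simp
  · intro i j
    fin_cases i <;> fin_cases j <;> simp [mul_assoc, *]

/-- The adjacency matrix of a gain graph on `G8`, the edges having the gains `a, b, c, d, e, f, g` in the order
in which they are listed in `G8`. -/
def adj8 (a b c d e f g : ℍ[ℝ]) : Matrix (Fin 6) (Fin 6) ℍ[ℝ] :=
    !![0, f, 0, 0, 0, e⁻¹;
      f⁻¹, 0, a, 0, 0, 0;
      0, a⁻¹, 0, b, 0, g;
      0, 0, b⁻¹, 0, c, 0;
      0, 0, 0, c⁻¹, 0, d;
      e, 0, g⁻¹, 0, d⁻¹, 0]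

/-- Eliminating 34 and 61 leaves only the pair 2, 5: its entry is the chord minus the gains of the
two outer paths. -/
theorem rowSpaceDim_adj8 {a b c d e f g : ℍ[ℝ]} (hc : c ≠ 0) (hf : f ≠ 0) :
    rowSpaceDim (adj8 a b c d e f g) = rowSpaceDim
      !![0, 0, 0, 0, 0, 0;
      0, 0, 0, 0, 0, 0;
      0, 0, 0, 0, 0, g - b * c * d - a⁻¹ * f⁻¹ * e⁻¹;
      0, 0, 0, 0, 0, 0;
      0, 0, 0, 0, 0, 0;
      0, 0, g⁻¹ - d⁻¹ * c⁻¹ * b⁻¹ - e * f * a, 0, 0, 0] + 4 := by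
  unfold adj8
  rw [rowSpaceDim_eq_add_two (B :=
      !![0, f, 0, 0, 0, e⁻¹;
      f⁻¹, 0, a, 0, 0, 0;
      0, a⁻¹, 0, 0, 0, g - b * c * d;
      0, 0, 0, 0, 0, 0;
      0, 0, 0, 0, 0, 0;
      e, 0, g⁻¹ - d⁻¹ * c⁻¹ * b⁻¹, 0, 0, 0]) 3 4,
    rowSpaceDim_eq_add_two (B :=
      !![0, 0, 0, 0, 0, 0;
      0, 0, 0, 0, 0, 0;
      0, 0, 0, 0, 0, g - b * c * d - a⁻¹ * f⁻¹ * e⁻¹;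
      0, 0, 0, 0, 0, 0;
      0, 0, 0, 0, 0, 0;
      0, 0, g⁻¹ - d⁻¹ * c⁻¹ * b⁻¹ - e * f * a, 0, 0, 0]) 0 1]
  · simp [*]
  · simp [*]
  · simp
  · simp
  · intro i j
    fin_cases i <;> fin_cases j <;> simp [mul_assoc, *]
  · simp [*]
  · simp [*]
  · simp
  · simp
  · intro i j
    fin_cases i <;> fin_cases j <;> simp [mul_assoc, *]

/-- The adjacency matrix of a gain graph on `G9`, the edges having the gains `a, b, c, d, e, f` in the order
in which they are listed in `G9`. -/
def adj9 (a b c d e f : ℍ[ℝ]) : Matrix (Fin 5) (Fin 5) ℍ[ℝ] :=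
    !![0, 0, e⁻¹, 0, f;
      0, 0, a, 0, d⁻¹;
      e, a⁻¹, 0, b, 0;
      0, 0, b⁻¹, 0, c;
      f⁻¹, d, 0, c⁻¹, 0]

theorem rowSpaceDim_adj9 {a b c d e f : ℍ[ℝ]} (ha : a ≠ 0) :
    rowSpaceDim (adj9 a b c d e f) = rowSpaceDim
      !![0, 0, 0, 0, f - e⁻¹ * a⁻¹ * d⁻¹;
      0, 0, 0, 0, 0;
      0, 0, 0, 0, 0;
      0, 0, 0, 0, c - b⁻¹ * a⁻¹ * d⁻¹;
      f⁻¹ - d * a * e, 0, 0, c⁻¹ - d * a * b, 0] + 2 := by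
  unfold adj9
  rw [rowSpaceDim_eq_add_two (B :=
      !![0, 0, 0, 0, f - e⁻¹ * a⁻¹ * d⁻¹;
      0, 0, 0, 0, 0;
      0, 0, 0, 0, 0;
      0, 0, 0, 0, c - b⁻¹ * a⁻¹ * d⁻¹;
      f⁻¹ - d * a * e, 0, 0, c⁻¹ - d * a * b, 0]) 1 2]
  · simp [*]
  · simp [*]
  · simp
  · simp
  · intro i j
    fin_cases i <;> fin_cases j <;> simp [mul_assoc, *]

/-- The adjacency matrix of a gain graph on `G10`, the edges having the gains `a, b, c, d, e, f, g` in the order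
in which they are listed in `G10`. -/
def adj10 (a b c d e f g : ℍ[ℝ]) : Matrix (Fin 6) (Fin 6) ℍ[ℝ] :=
    !![0, 0, f⁻¹, 0, 0, g;
      0, 0, a, 0, 0, e⁻¹;
      f, a⁻¹, 0, b, 0, 0;
      0, 0, b⁻¹, 0, c, 0;
      0, 0, 0, c⁻¹, 0, d;
      g⁻¹, e, 0, 0, d⁻¹, 0]

/-- After 34 is eliminated, the path 2,3,4,5 acts as an edge 25 with entry `-b * c * d`. Eliminating
12 then gives the 5-cycle on the diagonal at `v₅` and the 4-cycle at the edge 65. -/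
theorem rowSpaceDim_adj10 {a b c d e f g : ℍ[ℝ]} (ha : a ≠ 0) (hc : c ≠ 0) :
    rowSpaceDim (adj10 a b c d e f g) = rowSpaceDim
      !![0, 0, 0, 0, 0, g - f⁻¹ * a⁻¹ * e⁻¹;
      0, 0, 0, 0, 0, 0;
      0, 0, 0, 0, 0, 0;
      0, 0, 0, 0, 0, 0;
      0, 0, 0, 0, 0, 0;
      g⁻¹ - e * a * f, 0, 0, 0, 0, d⁻¹ * c⁻¹ * b⁻¹ * a⁻¹ * e⁻¹ + e * a * b * c * d] + 4 := by
  unfold adj10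
  rw [rowSpaceDim_eq_add_two (B :=
      !![0, 0, f⁻¹, 0, 0, g;
      0, 0, a, 0, 0, e⁻¹;
      f, a⁻¹, 0, 0, 0, -b * c * d;
      0, 0, 0, 0, 0, 0;
      0, 0, 0, 0, 0, 0;
      g⁻¹, e, -d⁻¹ * c⁻¹ * b⁻¹, 0, 0, 0]) 3 4,
    rowSpaceDim_eq_add_two (B :=
      !![0, 0, 0, 0, 0, g - f⁻¹ * a⁻¹ * e⁻¹;
      0, 0, 0, 0, 0, 0;
      0, 0, 0, 0, 0, 0;
      0, 0, 0, 0, 0, 0;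
      0, 0, 0, 0, 0, 0;
      g⁻¹ - e * a * f, 0, 0, 0, 0, d⁻¹ * c⁻¹ * b⁻¹ * a⁻¹ * e⁻¹ + e * a * b * c * d]) 1 2]
  · simp [*]
  · simp [*]
  · simp
  · simp
  · intro i j
    fin_cases i <;> fin_cases j <;> simp [mul_assoc, *]
  · simp [*]
  · simp [*]
  · simp
  · simp
  · intro i j
    fin_cases i <;> fin_cases j <;> simp [mul_assoc, *]

/-- The adjacency matrix of a gain graph on `G11`, the edges having the gains `a, b, c, d, e, f, g, h` in the order
in which they are listed in `G11`. -/
def adj11 (a b c d e f g h : ℍ[ℝ]) : Matrix (Fin 7) (Fin 7) ℍ[ℝ] :=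
    !![0, 0, g⁻¹, 0, 0, 0, h;
      0, 0, a, 0, 0, 0, f⁻¹;
      g, a⁻¹, 0, b, 0, 0, 0;
      0, 0, b⁻¹, 0, c, 0, 0;
      0, 0, 0, c⁻¹, 0, d, 0;
      0, 0, 0, 0, d⁻¹, 0, e;
      h⁻¹, f, 0, 0, 0, e⁻¹, 0]

theorem rowSpaceDim_adj11 {a b c d e f g h : ℍ[ℝ]} (ha : a ≠ 0) (hc : c ≠ 0) :
    rowSpaceDim (adj11 a b c d e f g h) = rowSpaceDim
      !![0, 0, 0, 0, 0, 0, h - g⁻¹ * a⁻¹ * f⁻¹;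
      0, 0, 0, 0, 0, 0, 0;
      0, 0, 0, 0, 0, 0, 0;
      0, 0, 0, 0, 0, 0, 0;
      0, 0, 0, 0, 0, 0, 0;
      0, 0, 0, 0, 0, 0, e + d⁻¹ * c⁻¹ * b⁻¹ * a⁻¹ * f⁻¹;
      h⁻¹ - f * a * g, 0, 0, 0, 0, e⁻¹ + f * a * b * c * d, 0] + 4 := by
  unfold adj11
  rw [rowSpaceDim_eq_add_two (B :=
      !![0, 0, g⁻¹, 0, 0, 0, h;
      0, 0, a, 0, 0, 0, f⁻¹;
      g, a⁻¹, 0, 0, 0, -b * c * d, 0;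
      0, 0, 0, 0, 0, 0, 0;
      0, 0, 0, 0, 0, 0, 0;
      0, 0, -d⁻¹ * c⁻¹ * b⁻¹, 0, 0, 0, e;
      h⁻¹, f, 0, 0, 0, e⁻¹, 0]) 3 4,
    rowSpaceDim_eq_add_two (B :=
      !![0, 0, 0, 0, 0, 0, h - g⁻¹ * a⁻¹ * f⁻¹;
      0, 0, 0, 0, 0, 0, 0;
      0, 0, 0, 0, 0, 0, 0;
      0, 0, 0, 0, 0, 0, 0;
      0, 0, 0, 0, 0, 0, 0;
      0, 0, 0, 0, 0, 0, e + d⁻¹ * c⁻¹ * b⁻¹ * a⁻¹ * f⁻¹;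
      h⁻¹ - f * a * g, 0, 0, 0, 0, e⁻¹ + f * a * b * c * d, 0]) 1 2]
  · simp [*]
  · simp [*]
  · simp
  · simp
  · intro i j
    fin_cases i <;> fin_cases j <;> simp [mul_assoc, *]
  · simp [*]
  · simp [*]
  · simp
  · simp
  · intro i j
    fin_cases i <;> fin_cases j <;> simp [mul_assoc, *]

/-! ### Neighbour lists of the eleven graphs. -/

section Adjacency

open SimpleGraph Set

theorem G1_adj (i j : Fin 5) : G1.Adj i j ↔
    (j : ℕ) ∈ [[1, 4], [3, 2, 0, 4], [3, 1], [1, 2], [0, 1]].getD (i : ℕ) [] := by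
  simp only [G1, fromEdgeSet_adj, mem_insert_iff, mem_singleton_iff]
  revert i j
  decide

theorem G2_adj (i j : Fin 6) : G2.Adj i j ↔
    (j : ℕ) ∈ [[5, 3], [2, 3], [1, 3], [2, 1, 4, 0], [3, 5], [4, 0]].getD (i : ℕ) [] := by
  simp only [G2, fromEdgeSet_adj, mem_insert_iff, mem_singleton_iff]
  revert i j
  decide

theorem G3_adj (i j : Fin 7) : G3.Adj i j ↔
    (j : ℕ) ∈ [[6, 4], [2, 3], [1, 4], [4, 1], [2, 3, 5, 0], [4, 6], [5, 0]].getD (i : ℕ) [] := by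
  simp only [G3, fromEdgeSet_adj, mem_insert_iff, mem_singleton_iff]
  revert i j
  decide

theorem G4_adj (i j : Fin 6) : G4.Adj i j ↔
    (j : ℕ) ∈ [[4, 5], [3, 2, 4], [3, 1], [1, 2], [0, 5, 1], [0, 4]].getD (i : ℕ) [] := by
  simp only [G4, fromEdgeSet_adj, mem_insert_iff, mem_singleton_iff]
  revert i j
  decide

theorem G5_adj (i j : Fin 4) : G5.Adj i j ↔
    (j : ℕ) ∈ [[3, 1, 2], [2, 0], [1, 3, 0], [2, 0]].getD (i : ℕ) [] := by
  simp only [G5, fromEdgeSet_adj, mem_insert_iff, mem_singleton_iff]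
  revert i j
  decide

theorem G6_adj (i j : Fin 5) : G6.Adj i j ↔
    (j : ℕ) ∈ [[4, 1, 2], [2, 0], [1, 3, 0], [2, 4], [3, 0]].getD (i : ℕ) [] := by
  simp only [G6, fromEdgeSet_adj, mem_insert_iff, mem_singleton_iff]
  revert i j
  decide

theorem G7_adj (i j : Fin 6) : G7.Adj i j ↔
    (j : ℕ) ∈ [[5, 1, 2], [2, 0], [1, 3, 0], [2, 4], [3, 5], [4, 0]].getD (i : ℕ) [] := by
  simp only [G7, fromEdgeSet_adj, mem_insert_iff, mem_singleton_iff]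
  revert i j
  decide

theorem G8_adj (i j : Fin 6) : G8.Adj i j ↔
    (j : ℕ) ∈ [[5, 1], [2, 0], [1, 3, 5], [2, 4], [3, 5], [4, 0, 2]].getD (i : ℕ) [] := by
  simp only [G8, fromEdgeSet_adj, mem_insert_iff, mem_singleton_iff]
  revert i j
  decide

theorem G9_adj (i j : Fin 5) : G9.Adj i j ↔
    (j : ℕ) ∈ [[2, 4], [2, 4], [1, 3, 0], [2, 4], [3, 1, 0]].getD (i : ℕ) [] := by
  simp only [G9, fromEdgeSet_adj, mem_insert_iff, mem_singleton_iff]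
  revert i j
  decide

theorem G10_adj (i j : Fin 6) : G10.Adj i j ↔
    (j : ℕ) ∈ [[2, 5], [2, 5], [1, 3, 0], [2, 4], [3, 5], [4, 1, 0]].getD (i : ℕ) [] := by
  simp only [G10, fromEdgeSet_adj, mem_insert_iff, mem_singleton_iff]
  revert i j
  decide

theorem G11_adj (i j : Fin 7) : G11.Adj i j ↔
    (j : ℕ) ∈ [[2, 6], [2, 6], [1, 3, 0], [2, 4], [3, 5], [4, 6], [5, 1, 0]].getD (i : ℕ) [] := by
  simp only [G11, fromEdgeSet_adj, mem_insert_iff, mem_singleton_iff]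
  revert i j
  decide

end Adjacency

/-! ### Vanishing of residue entries and gains of cycles. -/

section Algebra

theorem sub_inv_eq_zero_iff {w u : ℍ[ℝ]} (hu : u ≠ 0) : w - u⁻¹ = 0 ↔ u * w = 1 := by
  rw [sub_eq_zero]
  constructor
  · rintro rfl
    exact mul_inv_cancel₀ hu
  · exact eq_inv_of_mul_eq_one_right

/-- This frees the real part of the gain of a cycle from the choice of its starting vertex. -/
theorem re_mul_comm (p q : ℍ[ℝ]) : (p * q).re = (q * p).re := by
  simp only [Quaternion.re_mul]
  ring

theorem star_add_self_eq_zero_iff {q : ℍ[ℝ]} : star q + q = 0 ↔ q.re = 0 := by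
  constructor
  · intro h
    have := congrArg QuaternionAlgebra.re h
    simp only [Quaternion.re_add, Quaternion.re_star, Quaternion.re_zero] at this
    linarith
  · intro h
    rw [Quaternion.star_add_self, h]
    simp

theorem sub_star_sub_eq_zero_iff {p q : ℍ[ℝ]} :
    -star p - p - star q - q = 0 ↔ p.re + q.re = 0 := by
  rw [show -star p - p - star q - q = -(star (p + q) + (p + q)) by rw [star_add]; abel,
    neg_eq_zero, star_add_self_eq_zero_iff, Quaternion.re_add]

theorem neg_star_sub_eq_zero_iff {q : ℍ[ℝ]} : -star q - q = 0 ↔ q.re = 0 := by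
  rw [← star_add_self_eq_zero_iff, ← neg_add', neg_eq_zero]

end Algebra

/-! ### Transport along a labelling; the types as equations in the gains. -/

namespace UQGainGraph

variable {V : Type*} {Γ : UQGainGraph V}

section

variable {n : ℕ} {H : SimpleGraph (Fin n)} (e : H ≃g Γ.graph)

theorem adjMatrix_eq_zero {i j : Fin n} (h : ¬ H.Adj i j) : Γ.adjMatrix (e i) (e j) = 0 := by
  by_contra h0
  exact h (e.map_adj_iff.1 (Γ.adjMatrix_ne_zero_iff.1 h0))

theorem adjMatrix_ne_zero {i j : Fin n} (h : H.Adj i j) : Γ.adjMatrix (e i) (e j) ≠ 0 :=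
  Γ.adjMatrix_ne_zero_iff.2 (e.map_adj_iff.2 h)

theorem rank_eq_of_iso [Fintype V] {B : Matrix (Fin n) (Fin n) ℍ[ℝ]}
    (hB : ∀ i j, Γ.adjMatrix (e i) (e j) = B i j) : Γ.rank = rowSpaceDim B := by
  rw [rank, leftRowRank_eq_rowSpaceDim, ← rowSpaceDim_reindex e.toEquiv]
  congr 1
  ext1 i j
  exact hB i j

end

theorem type1_four {v₁ v₂ v₃ v₄ : V} : Γ.Type1 [v₁, v₂, v₃, v₄] ↔
    Γ.adjMatrix v₁ v₂ * Γ.adjMatrix v₂ v₃ * Γ.adjMatrix v₃ v₄ * Γ.adjMatrix v₄ v₁ = 1 := by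
  have : Even 4 := by decide
  simp [Type1, cycleGain, walkGain, mul_assoc, this]

theorem type2_four {v₁ v₂ v₃ v₄ : V} : Γ.Type2 [v₁, v₂, v₃, v₄] ↔
    Γ.adjMatrix v₁ v₂ * Γ.adjMatrix v₂ v₃ * Γ.adjMatrix v₃ v₄ * Γ.adjMatrix v₄ v₁ ≠ 1 := by
  have : Even 4 := by decide
  simp [Type2, cycleGain, walkGain, mul_assoc, this]

theorem type1_six {v₁ v₂ v₃ v₄ v₅ v₆ : V} : Γ.Type1 [v₁, v₂, v₃, v₄, v₅, v₆] ↔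
    Γ.adjMatrix v₁ v₂ * Γ.adjMatrix v₂ v₃ * Γ.adjMatrix v₃ v₄ * Γ.adjMatrix v₄ v₅ *
      Γ.adjMatrix v₅ v₆ * Γ.adjMatrix v₆ v₁ = -1 := by
  have : Even 6 := by decide
  have h3 : (-1 : ℍ[ℝ]) ^ 3 = -1 := by noncomm_ring
  simp [Type1, cycleGain, walkGain, mul_assoc, this, h3]

theorem type3_three {v₁ v₂ v₃ : V} : Γ.Type3 [v₁, v₂, v₃] ↔
    (Γ.adjMatrix v₁ v₂ * Γ.adjMatrix v₂ v₃ * Γ.adjMatrix v₃ v₁).re ≠ 0 := by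
  have : Odd 3 := by decide
  simp [Type3, cycleGain, walkGain, mul_assoc, this, -Quaternion.re_mul]

theorem type4_three {v₁ v₂ v₃ : V} : Γ.Type4 [v₁, v₂, v₃] ↔
    (Γ.adjMatrix v₁ v₂ * Γ.adjMatrix v₂ v₃ * Γ.adjMatrix v₃ v₁).re = 0 := by
  have : Odd 3 := by decide
  simp [Type4, cycleGain, walkGain, mul_assoc, this, -Quaternion.re_mul]

theorem type4_five {v₁ v₂ v₃ v₄ v₅ : V} : Γ.Type4 [v₁, v₂, v₃, v₄, v₅] ↔
    (Γ.adjMatrix v₁ v₂ * Γ.adjMatrix v₂ v₃ * Γ.adjMatrix v₃ v₄ * Γ.adjMatrix v₄ v₅ *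
      Γ.adjMatrix v₅ v₁).re = 0 := by
  have : Odd 5 := by decide
  simp [Type4, cycleGain, walkGain, mul_assoc, this, -Quaternion.re_mul]

end UQGainGraph

/-- Two eliminated edges already account for rank 4, so ranks 2 and 3 are impossible and rank 4
means a zero residue. -/
theorem add_four_eq_iff {k r : ℕ} (hr : r = 2 ∨ r = 3 ∨ r = 4) {P : Prop} (hP : k = 0 ↔ P) :
    k + 4 = r ↔ r = 4 ∧ P := by
  rw [← hP]
  omega

/-! ### The gain conditions, graph by graph. -/

namespace UQGainGraph

variable {V : Type*} [Fintype V] {Γ : UQGainGraph V}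

/-- The pivot `x` clears the rest of its row, `t` included, so the diagonal entry does not affect
the rank. -/
theorem rowSpaceDim_corner {t x x' : ℍ[ℝ]} (hx : x ≠ 0) (hx' : x' ≠ 0) :
    rowSpaceDim !![t, 0, 0, x; 0, 0, 0, 0; 0, 0, 0, 0; x', 0, 0, 0] = 2 := by
  rw [rowSpaceDim_eq_add_one (B := !![0, 0, 0, 0; 0, 0, 0, 0; 0, 0, 0, 0; x', 0, 0, 0]) 0 3,
    rowSpaceDim_eq_add_one (B := 0) 3 0, rowSpaceDim_eq_zero_iff.2 rfl]
  · simpa using hx'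
  · intro i j
    fin_cases i <;> fin_cases j <;> simp [hx']
  · simpa using hx
  · intro i j
    fin_cases i <;> fin_cases j <;> simp [hx]

theorem rowSpaceDim_single {t : ℍ[ℝ]} (ht : t ≠ 0) :
    rowSpaceDim !![t, 0, 0, 0; 0, 0, 0, 0; 0, 0, 0, 0; 0, 0, 0, 0] = 1 := by
  rw [rowSpaceDim_eq_add_one (B := 0) 0 0, rowSpaceDim_eq_zero_iff.2 rfl]
  · simpa using ht
  · intro i j
    fin_cases i <;> fin_cases j <;> simp [ht]

/-- Only one row and one column are occupied, so a single conjugate pair of pivots clears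
everything. -/
theorem rowSpaceDim_border {x y x' y' : ℍ[ℝ]} (h : x ≠ 0 ∧ x' ≠ 0 ∨ y ≠ 0 ∧ y' ≠ 0) :
    rowSpaceDim !![0, 0, 0, 0, x; 0, 0, 0, 0, 0; 0, 0, 0, 0, 0; 0, 0, 0, 0, y;
      x', 0, 0, y', 0] = 2 := by
  rcases h with ⟨h, h'⟩ | ⟨h, h'⟩
  · rw [rowSpaceDim_eq_add_two (B := 0) 0 4, rowSpaceDim_eq_zero_iff.2 rfl]
    · simpa using h
    · simpa using h'
    · simp
    · simp
    · intro i j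
      fin_cases i <;> fin_cases j <;> simp [h, h']
  · rw [rowSpaceDim_eq_add_two (B := 0) 3 4, rowSpaceDim_eq_zero_iff.2 rfl]
    · simpa using h
    · simpa using h'
    · simp
    · simp
    · intro i j
      fin_cases i <;> fin_cases j <;> simp [h, h']

theorem rank_eq_iff_tab1 (ψ : G1 ≃g Γ.graph) {r : ℕ} (hr : r = 2 ∨ r = 3 ∨ r = 4) :
    Γ.rank = r ↔ Γ.tab1 ψ r := by
  -- Each entry is a non-edge, an edge in the listed direction, or a reversed edge, whose gain is
  -- the inverse.
  have hB := rank_eq_of_iso ψ (B := adj1 (Γ.adjMatrix (ψ 1) (ψ 3)) (Γ.adjMatrix (ψ 3) (ψ 2))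
    (Γ.adjMatrix (ψ 2) (ψ 1)) (Γ.adjMatrix (ψ 1) (ψ 5)) (Γ.adjMatrix (ψ 5) (ψ 4))
    (Γ.adjMatrix (ψ 4) (ψ 1))) (by
      intro i j
      fin_cases i <;> fin_cases j <;>
      first
      | exact adjMatrix_eq_zero ψ ((G1_adj _ _).not.2 (by decide))
      | rfl
      | exact Γ.adjMatrix_symm _ _)
  rw [hB, rowSpaceDim_adj1 (adjMatrix_ne_zero ψ ((G1_adj _ _).2 (by decide)))
    (adjMatrix_ne_zero ψ ((G1_adj _ _).2 (by decide))), tab1]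
  refine add_four_eq_iff hr ?_
  rw [rowSpaceDim_eq_zero_iff]
  simp only [← Matrix.ext_iff, Fin.forall_fin_succ]
  simp [← star_adjMatrix, cycleGain, walkGain, ← sub_star_sub_eq_zero_iff, mul_assoc,
    -Quaternion.re_mul]

theorem rank_eq_iff_tab2 (ψ : G2 ≃g Γ.graph) {r : ℕ} (hr : r = 2 ∨ r = 3 ∨ r = 4) :
    Γ.rank = r ↔ Γ.tab2 ψ r := by
  have hB := rank_eq_of_iso ψ (B := adj2 (Γ.adjMatrix (ψ 1) (ψ 2)) (Γ.adjMatrix (ψ 2) (ψ 3))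
    (Γ.adjMatrix (ψ 3) (ψ 1)) (Γ.adjMatrix (ψ 3) (ψ 4)) (Γ.adjMatrix (ψ 4) (ψ 5))
    (Γ.adjMatrix (ψ 5) (ψ 6)) (Γ.adjMatrix (ψ 6) (ψ 3))) (by
      intro i j
      fin_cases i <;> fin_cases j <;>
      first
      | exact adjMatrix_eq_zero ψ ((G2_adj _ _).not.2 (by decide))
      | rfl
      | exact Γ.adjMatrix_symm _ _)
  rw [hB, rowSpaceDim_adj2 (adjMatrix_ne_zero ψ ((G2_adj _ _).2 (by decide)))
    (adjMatrix_ne_zero ψ ((G2_adj _ _).2 (by decide))), tab2]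
  refine add_four_eq_iff hr ?_
  rw [rowSpaceDim_eq_zero_iff, type1_four, type4_three]
  clear hB
  have ha := adjMatrix_ne_zero ψ ((G2_adj 1 2).2 (by decide))
  have sa := Γ.star_adjMatrix (ψ 1) (ψ 2)
  have sb := Γ.star_adjMatrix (ψ 2) (ψ 3)
  have sc := Γ.star_adjMatrix (ψ 3) (ψ 1)
  have hd := adjMatrix_ne_zero ψ ((G2_adj 3 4).2 (by decide))
  have sd := Γ.star_adjMatrix (ψ 3) (ψ 4)
  have he := adjMatrix_ne_zero ψ ((G2_adj 4 5).2 (by decide))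
  have se := Γ.star_adjMatrix (ψ 4) (ψ 5)
  have hf := adjMatrix_ne_zero ψ ((G2_adj 5 6).2 (by decide))
  have sf := Γ.star_adjMatrix (ψ 5) (ψ 6)
  have sg := Γ.star_adjMatrix (ψ 6) (ψ 3)
  generalize Γ.adjMatrix (ψ 1) (ψ 2) = a at *
  generalize Γ.adjMatrix (ψ 2) (ψ 3) = b at *
  generalize Γ.adjMatrix (ψ 3) (ψ 1) = c at *
  generalize Γ.adjMatrix (ψ 3) (ψ 4) = d at *
  generalize Γ.adjMatrix (ψ 4) (ψ 5) = e at *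
  generalize Γ.adjMatrix (ψ 5) (ψ 6) = f at *
  generalize Γ.adjMatrix (ψ 6) (ψ 3) = g at *
  have h1 : g - f⁻¹ * e⁻¹ * d⁻¹ = 0 ↔ d * e * f * g = 1 := by
    rw [← sub_inv_eq_zero_iff (by simp [*])]
    simp [mul_assoc]
  have h2 : g⁻¹ - d * e * f = star (g - f⁻¹ * e⁻¹ * d⁻¹) := by
    simp [mul_assoc, *]
  have h3 : -b⁻¹ * a⁻¹ * c⁻¹ - c * a * b = 0 ↔ (a * b * c).re = 0 := by
    rw [re_mul_comm, ← mul_assoc, ← neg_star_sub_eq_zero_iff]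
    simp [mul_assoc, *]
  rw [← h1, ← h3]
  -- The residue is Hermitian, so entries in symmetric positions are conjugate and vanish together.
  trans g - f⁻¹ * e⁻¹ * d⁻¹ = 0 ∧ star (g - f⁻¹ * e⁻¹ * d⁻¹) = 0 ∧
    -b⁻¹ * a⁻¹ * c⁻¹ - c * a * b = 0
  · rw [← h2]
    simp only [← Matrix.ext_iff, Fin.forall_fin_succ]
    simp
  · rw [star_eq_zero]
    tauto

theorem rank_eq_iff_tab3 (ψ : G3 ≃g Γ.graph) {r : ℕ} (hr : r = 2 ∨ r = 3 ∨ r = 4) :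
    Γ.rank = r ↔ Γ.tab3 ψ r := by
  have hB := rank_eq_of_iso ψ (B := adj3 (Γ.adjMatrix (ψ 1) (ψ 2)) (Γ.adjMatrix (ψ 2) (ψ 4))
    (Γ.adjMatrix (ψ 4) (ψ 3)) (Γ.adjMatrix (ψ 3) (ψ 1)) (Γ.adjMatrix (ψ 4) (ψ 5))
    (Γ.adjMatrix (ψ 5) (ψ 6)) (Γ.adjMatrix (ψ 6) (ψ 7)) (Γ.adjMatrix (ψ 7) (ψ 4))) (by
      intro i j
      fin_cases i <;> fin_cases j <;>
      first
      | exact adjMatrix_eq_zero ψ ((G3_adj _ _).not.2 (by decide))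
      | rfl
      | exact Γ.adjMatrix_symm _ _)
  rw [hB, rowSpaceDim_adj3 (adjMatrix_ne_zero ψ ((G3_adj _ _).2 (by decide)))
    (adjMatrix_ne_zero ψ ((G3_adj _ _).2 (by decide))), tab3]
  refine add_four_eq_iff hr ?_
  rw [rowSpaceDim_eq_zero_iff, type1_four, type1_four]
  clear hB
  have ha := adjMatrix_ne_zero ψ ((G3_adj 1 2).2 (by decide))
  have sa := Γ.star_adjMatrix (ψ 1) (ψ 2)
  have hb := adjMatrix_ne_zero ψ ((G3_adj 2 4).2 (by decide))
  have sb := Γ.star_adjMatrix (ψ 2) (ψ 4)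
  have sc := Γ.star_adjMatrix (ψ 4) (ψ 3)
  have hd := adjMatrix_ne_zero ψ ((G3_adj 3 1).2 (by decide))
  have sd := Γ.star_adjMatrix (ψ 3) (ψ 1)
  have he := adjMatrix_ne_zero ψ ((G3_adj 4 5).2 (by decide))
  have se := Γ.star_adjMatrix (ψ 4) (ψ 5)
  have hf := adjMatrix_ne_zero ψ ((G3_adj 5 6).2 (by decide))
  have sf := Γ.star_adjMatrix (ψ 5) (ψ 6)
  have hg := adjMatrix_ne_zero ψ ((G3_adj 6 7).2 (by decide))
  have sg := Γ.star_adjMatrix (ψ 6) (ψ 7)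
  have sh := Γ.star_adjMatrix (ψ 7) (ψ 4)
  generalize Γ.adjMatrix (ψ 1) (ψ 2) = a at *
  generalize Γ.adjMatrix (ψ 2) (ψ 4) = b at *
  generalize Γ.adjMatrix (ψ 4) (ψ 3) = c at *
  generalize Γ.adjMatrix (ψ 3) (ψ 1) = d at *
  generalize Γ.adjMatrix (ψ 4) (ψ 5) = e at *
  generalize Γ.adjMatrix (ψ 5) (ψ 6) = f at *
  generalize Γ.adjMatrix (ψ 6) (ψ 7) = g at *
  generalize Γ.adjMatrix (ψ 7) (ψ 4) = h at *
  have h1 : h - g⁻¹ * f⁻¹ * e⁻¹ = 0 ↔ e * f * g * h = 1 := by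
    rw [← sub_inv_eq_zero_iff (by simp [*])]
    simp [mul_assoc]
  have h2 : h⁻¹ - e * f * g = star (h - g⁻¹ * f⁻¹ * e⁻¹) := by
    simp [mul_assoc, *]
  -- `mul_eq_one_comm` rotates the cycle so that `c` comes last; whether a gain equals 1 does not
  -- depend on the starting vertex.
  have h3 : c - b⁻¹ * a⁻¹ * d⁻¹ = 0 ↔ a * b * c * d = 1 := by
    rw [mul_eq_one_comm, ← mul_assoc, ← sub_inv_eq_zero_iff (u := d * (a * b)) (by simp [*])]
    simp [mul_assoc]
  have h4 : c⁻¹ - d * a * b = star (c - b⁻¹ * a⁻¹ * d⁻¹) := by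
    simp [mul_assoc, *]
  rw [← h1, ← h3]
  trans h - g⁻¹ * f⁻¹ * e⁻¹ = 0 ∧ star (c - b⁻¹ * a⁻¹ * d⁻¹) = 0 ∧
    star (h - g⁻¹ * f⁻¹ * e⁻¹) = 0 ∧ c - b⁻¹ * a⁻¹ * d⁻¹ = 0
  · rw [← h2, ← h4]
    simp only [← Matrix.ext_iff, Fin.forall_fin_succ]
    simp
  · rw [star_eq_zero, star_eq_zero]
    tauto

theorem rank_eq_iff_tab4 (ψ : G4 ≃g Γ.graph) {r : ℕ} (hr : r = 2 ∨ r = 3 ∨ r = 4) :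
    Γ.rank = r ↔ Γ.tab4 ψ r := by
  have hB := rank_eq_of_iso ψ (B := adj4 (Γ.adjMatrix (ψ 1) (ψ 3)) (Γ.adjMatrix (ψ 3) (ψ 2))
    (Γ.adjMatrix (ψ 2) (ψ 1)) (Γ.adjMatrix (ψ 4) (ψ 6)) (Γ.adjMatrix (ψ 6) (ψ 5))
    (Γ.adjMatrix (ψ 5) (ψ 4)) (Γ.adjMatrix (ψ 1) (ψ 4))) (by
      intro i j
      fin_cases i <;> fin_cases j <;>
      first
      | exact adjMatrix_eq_zero ψ ((G4_adj _ _).not.2 (by decide))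
      | rfl
      | exact Γ.adjMatrix_symm _ _)
  rw [hB, rowSpaceDim_adj4 (adjMatrix_ne_zero ψ ((G4_adj _ _).2 (by decide)))
    (adjMatrix_ne_zero ψ ((G4_adj _ _).2 (by decide))), tab4]
  refine iff_of_false (fun h => ?_) id
  have h0 := rowSpaceDim_eq_zero_iff.1 ((add_four_eq_iff hr Iff.rfl).1 h).2
  -- The residue contains the gain of the joining edge, which is never 0; hence the rank always
  -- exceeds 4.
  have h14 := congrFun (congrFun h0 1) 4
  exact adjMatrix_ne_zero ψ ((G4_adj 1 4).2 (by decide)) h14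

theorem rank_eq_iff_tab5 (ψ : G5 ≃g Γ.graph) {r : ℕ} (hr : r = 2 ∨ r = 3 ∨ r = 4) :
    Γ.rank = r ↔ Γ.tab5 ψ r := by
  have hB := rank_eq_of_iso ψ (B := adj5 (Γ.adjMatrix (ψ 1) (ψ 2)) (Γ.adjMatrix (ψ 2) (ψ 3))
    (Γ.adjMatrix (ψ 3) (ψ 4)) (Γ.adjMatrix (ψ 4) (ψ 1)) (Γ.adjMatrix (ψ 2) (ψ 4))) (by
      intro i j
      fin_cases i <;> fin_cases j <;>
      first
      | exact adjMatrix_eq_zero ψ ((G5_adj _ _).not.2 (by decide))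
      | rfl
      | exact Γ.adjMatrix_symm _ _)
  rw [hB, rowSpaceDim_adj5 (adjMatrix_ne_zero ψ ((G5_adj _ _).2 (by decide))), tab5]
  simp only [type1_four, type2_four, type3_three, type4_three]
  clear hB
  have ha := adjMatrix_ne_zero ψ ((G5_adj 1 2).2 (by decide))
  have sa := Γ.star_adjMatrix (ψ 1) (ψ 2)
  have hb := adjMatrix_ne_zero ψ ((G5_adj 2 3).2 (by decide))
  have sb := Γ.star_adjMatrix (ψ 2) (ψ 3)
  have sc := Γ.star_adjMatrix (ψ 3) (ψ 4)
  have hd := adjMatrix_ne_zero ψ ((G5_adj 4 1).2 (by decide))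
  have sd := Γ.star_adjMatrix (ψ 4) (ψ 1)
  have se := Γ.star_adjMatrix (ψ 2) (ψ 4)
  generalize Γ.adjMatrix (ψ 1) (ψ 2) = a at *
  generalize Γ.adjMatrix (ψ 2) (ψ 3) = b at *
  generalize Γ.adjMatrix (ψ 3) (ψ 4) = c at *
  generalize Γ.adjMatrix (ψ 4) (ψ 1) = d at *
  generalize Γ.adjMatrix (ψ 2) (ψ 4) = e at *
  have h1 : a * b * c * d = 1 ↔ c - b⁻¹ * a⁻¹ * d⁻¹ = 0 := by
    rw [mul_eq_one_comm, ← mul_assoc, ← sub_inv_eq_zero_iff (u := d * (a * b)) (by simp [*])]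
    simp [mul_assoc]
  have h2 : c⁻¹ - d * a * b = star (c - b⁻¹ * a⁻¹ * d⁻¹) := by
    simp [mul_assoc, *]
  have h3 : (a * e * d).re = 0 ↔ -e⁻¹ * a⁻¹ * d⁻¹ - d * a * e = 0 := by
    rw [re_mul_comm, ← mul_assoc, ← neg_star_sub_eq_zero_iff]
    simp [mul_assoc, *]
  rw [h2, ne_eq, ne_eq, h1, h3]
  generalize -e⁻¹ * a⁻¹ * d⁻¹ - d * a * e = t
  generalize c - b⁻¹ * a⁻¹ * d⁻¹ = x
  -- `x` measures the quadrangle and `t` the triangle. The residue has rank 2 if `x ≠ 0`, and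
  -- otherwise rank 0 or 1 according to `t`.
  rcases eq_or_ne x 0 with rfl | hx
  · rw [star_zero]
    rcases eq_or_ne t 0 with rfl | ht
    · rw [rowSpaceDim_eq_zero_iff.2]
      · simp only [not_true_eq_false, and_true, and_false, or_false]
        omega
      · simp only [← Matrix.ext_iff, Fin.forall_fin_succ]
        simp
    · rw [rowSpaceDim_single ht]
      simp only [ht, not_true_eq_false, not_false_eq_true, and_true, and_false, or_false,
        false_or]
      omega
  · rw [rowSpaceDim_corner (star_ne_zero.2 hx) hx]
    simp only [hx, not_false_eq_true, and_true, and_false, false_or]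
    tauto

theorem rank_eq_iff_tab6 (ψ : G6 ≃g Γ.graph) {r : ℕ} (hr : r = 2 ∨ r = 3 ∨ r = 4) :
    Γ.rank = r ↔ Γ.tab6 ψ r := by
  have hB := rank_eq_of_iso ψ (B := adj6 (Γ.adjMatrix (ψ 1) (ψ 2)) (Γ.adjMatrix (ψ 2) (ψ 3))
    (Γ.adjMatrix (ψ 3) (ψ 4)) (Γ.adjMatrix (ψ 4) (ψ 5)) (Γ.adjMatrix (ψ 5) (ψ 1))
    (Γ.adjMatrix (ψ 2) (ψ 5))) (by
      intro i j
      fin_cases i <;> fin_cases j <;>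
      first
      | exact adjMatrix_eq_zero ψ ((G6_adj _ _).not.2 (by decide))
      | rfl
      | exact Γ.adjMatrix_symm _ _)
  rw [hB, rowSpaceDim_adj6 (adjMatrix_ne_zero ψ ((G6_adj _ _).2 (by decide)))
    (adjMatrix_ne_zero ψ ((G6_adj _ _).2 (by decide))), tab6]
  refine add_four_eq_iff hr ?_
  rw [rowSpaceDim_eq_zero_iff]
  simp only [cycleGain, walkGain, List.cons_append, List.nil_append, mul_one]
  clear hB
  have sa := Γ.star_adjMatrix (ψ 1) (ψ 2)
  have sb := Γ.star_adjMatrix (ψ 2) (ψ 3)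
  have sc := Γ.star_adjMatrix (ψ 3) (ψ 4)
  have sd := Γ.star_adjMatrix (ψ 4) (ψ 5)
  have se := Γ.star_adjMatrix (ψ 5) (ψ 1)
  have sf := Γ.star_adjMatrix (ψ 2) (ψ 5)
  generalize Γ.adjMatrix (ψ 1) (ψ 2) = a at *
  generalize Γ.adjMatrix (ψ 2) (ψ 3) = b at *
  generalize Γ.adjMatrix (ψ 3) (ψ 4) = c at *
  generalize Γ.adjMatrix (ψ 4) (ψ 5) = d at *
  generalize Γ.adjMatrix (ψ 5) (ψ 1) = e at *
  generalize Γ.adjMatrix (ψ 2) (ψ 5) = f at *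
  -- The entry is minus twice the real part of one quaternion: the gain of the triangle minus that
  -- of the 5-cycle, both read from `v₅`.
  have h1 : -((f⁻¹ - d⁻¹ * c⁻¹ * b⁻¹) * a⁻¹ * e⁻¹) - e * a * (f - b * c * d) =
      -star (e * (a * (f - b * c * d))) - e * (a * (f - b * c * d)) := by
    simp [mul_assoc, *]
  have h2 : (a * (f * e)).re - (a * (b * (c * (d * e)))).re = (e * (a * (f - b * c * d))).re := by
    rw [re_mul_comm e, ← Quaternion.re_sub]
    simp only [mul_assoc, mul_sub, sub_mul]
  rw [h1, h2, ← neg_star_sub_eq_zero_iff]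
  simp only [← Matrix.ext_iff, Fin.forall_fin_succ]
  simp

theorem rank_eq_iff_tab7 (ψ : G7 ≃g Γ.graph) {r : ℕ} (hr : r = 2 ∨ r = 3 ∨ r = 4) :
    Γ.rank = r ↔ Γ.tab7 ψ r := by
  have hB := rank_eq_of_iso ψ (B := adj7 (Γ.adjMatrix (ψ 1) (ψ 2)) (Γ.adjMatrix (ψ 2) (ψ 3))
    (Γ.adjMatrix (ψ 3) (ψ 4)) (Γ.adjMatrix (ψ 4) (ψ 5)) (Γ.adjMatrix (ψ 5) (ψ 6))
    (Γ.adjMatrix (ψ 6) (ψ 1)) (Γ.adjMatrix (ψ 2) (ψ 6))) (by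
      intro i j
      fin_cases i <;> fin_cases j <;>
      first
      | exact adjMatrix_eq_zero ψ ((G7_adj _ _).not.2 (by decide))
      | rfl
      | exact Γ.adjMatrix_symm _ _)
  rw [hB, rowSpaceDim_adj7 (adjMatrix_ne_zero ψ ((G7_adj _ _).2 (by decide)))
    (adjMatrix_ne_zero ψ ((G7_adj _ _).2 (by decide))), tab7]
  refine add_four_eq_iff hr ?_
  rw [rowSpaceDim_eq_zero_iff, type4_three, type1_six]
  clear hB
  have sa := Γ.star_adjMatrix (ψ 1) (ψ 2)
  have sb := Γ.star_adjMatrix (ψ 2) (ψ 3)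
  have hc := adjMatrix_ne_zero ψ ((G7_adj 3 4).2 (by decide))
  have sc := Γ.star_adjMatrix (ψ 3) (ψ 4)
  have hd := adjMatrix_ne_zero ψ ((G7_adj 4 5).2 (by decide))
  have sd := Γ.star_adjMatrix (ψ 4) (ψ 5)
  have he := adjMatrix_ne_zero ψ ((G7_adj 5 6).2 (by decide))
  have se := Γ.star_adjMatrix (ψ 5) (ψ 6)
  have sf := Γ.star_adjMatrix (ψ 6) (ψ 1)
  have sg := Γ.star_adjMatrix (ψ 2) (ψ 6)
  generalize Γ.adjMatrix (ψ 1) (ψ 2) = a at *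
  generalize Γ.adjMatrix (ψ 2) (ψ 3) = b at *
  generalize Γ.adjMatrix (ψ 3) (ψ 4) = c at *
  generalize Γ.adjMatrix (ψ 4) (ψ 5) = d at *
  generalize Γ.adjMatrix (ψ 5) (ψ 6) = e at *
  generalize Γ.adjMatrix (ψ 6) (ψ 1) = f at *
  generalize Γ.adjMatrix (ψ 2) (ψ 6) = g at *
  -- The path 6,1,2,3 enters with a minus sign, so the entry vanishes when the gain of the 6-cycle
  -- is -1.
  have h1 : -f * a * b - e⁻¹ * d⁻¹ * c⁻¹ = 0 ↔ a * b * c * d * e * f = -1 := by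
    have : a * b * c * d * e * f = -(a * b * (c * d * e * -f)) := by simp [mul_assoc]
    rw [this, neg_inj, mul_eq_one_comm, mul_assoc _ (-f),
      ← sub_inv_eq_zero_iff (u := c * d * e) (by simp [*])]
    simp [mul_assoc]
  have h2 : -b⁻¹ * a⁻¹ * f⁻¹ - c * d * e = star (-f * a * b - e⁻¹ * d⁻¹ * c⁻¹) := by
    simp [mul_assoc, *]
  have h3 : -g⁻¹ * a⁻¹ * f⁻¹ - f * a * g = 0 ↔ (a * g * f).re = 0 := by
    rw [re_mul_comm, ← mul_assoc, ← neg_star_sub_eq_zero_iff]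
    simp [mul_assoc, *]
  rw [← h1, ← h3]
  trans -g⁻¹ * a⁻¹ * f⁻¹ - f * a * g = 0 ∧ -f * a * b - e⁻¹ * d⁻¹ * c⁻¹ = 0 ∧
    star (-f * a * b - e⁻¹ * d⁻¹ * c⁻¹) = 0
  · rw [← h2]
    simp only [← Matrix.ext_iff, Fin.forall_fin_succ]
    simp [and_assoc]
  · rw [star_eq_zero]
    tauto

theorem rank_eq_iff_tab8 (ψ : G8 ≃g Γ.graph) {r : ℕ} (hr : r = 2 ∨ r = 3 ∨ r = 4) :
    Γ.rank = r ↔ Γ.tab8 ψ r := by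
  have hB := rank_eq_of_iso ψ (B := adj8 (Γ.adjMatrix (ψ 1) (ψ 2)) (Γ.adjMatrix (ψ 2) (ψ 3))
    (Γ.adjMatrix (ψ 3) (ψ 4)) (Γ.adjMatrix (ψ 4) (ψ 5)) (Γ.adjMatrix (ψ 5) (ψ 6))
    (Γ.adjMatrix (ψ 6) (ψ 1)) (Γ.adjMatrix (ψ 2) (ψ 5))) (by
      intro i j
      fin_cases i <;> fin_cases j <;>
      first
      | exact adjMatrix_eq_zero ψ ((G8_adj _ _).not.2 (by decide))
      | rfl
      | exact Γ.adjMatrix_symm _ _)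
  rw [hB, rowSpaceDim_adj8 (adjMatrix_ne_zero ψ ((G8_adj _ _).2 (by decide)))
    (adjMatrix_ne_zero ψ ((G8_adj _ _).2 (by decide))), tab8]
  refine add_four_eq_iff hr ?_
  rw [rowSpaceDim_eq_zero_iff]
  simp only [cycleGain, walkGain, List.cons_append, List.nil_append, mul_one]
  clear hB
  have ha := adjMatrix_ne_zero ψ ((G8_adj 1 2).2 (by decide))
  have sa := Γ.star_adjMatrix (ψ 1) (ψ 2)
  have sb := Γ.star_adjMatrix (ψ 2) (ψ 3)
  have sc := Γ.star_adjMatrix (ψ 3) (ψ 4)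
  have sd := Γ.star_adjMatrix (ψ 4) (ψ 5)
  have he := adjMatrix_ne_zero ψ ((G8_adj 5 6).2 (by decide))
  have se := Γ.star_adjMatrix (ψ 5) (ψ 6)
  have hf := adjMatrix_ne_zero ψ ((G8_adj 6 1).2 (by decide))
  have sf := Γ.star_adjMatrix (ψ 6) (ψ 1)
  have sg := Γ.star_adjMatrix (ψ 2) (ψ 5)
  generalize Γ.adjMatrix (ψ 1) (ψ 2) = a at *
  generalize Γ.adjMatrix (ψ 2) (ψ 3) = b at *
  generalize Γ.adjMatrix (ψ 3) (ψ 4) = c at *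
  generalize Γ.adjMatrix (ψ 4) (ψ 5) = d at *
  generalize Γ.adjMatrix (ψ 5) (ψ 6) = e at *
  generalize Γ.adjMatrix (ψ 6) (ψ 1) = f at *
  generalize Γ.adjMatrix (ψ 2) (ψ 5) = g at *
  -- Multiplying the residue entry by the units `a` on the left and `e * f` on the right closes the
  -- three paths from 2 to 5 through 5,6,1,2; the path through 6 and 1 becomes trivial and yields
  -- the summand 1.
  have h1 : a * (b * (c * (d * (e * f)))) - a * (g * (e * f)) + 1 =
      -(a * (g - b * c * d - a⁻¹ * f⁻¹ * e⁻¹) * (e * f)) := by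
    simp [mul_assoc, mul_sub, sub_mul, *]
    abel
  have h2 : g⁻¹ - d⁻¹ * c⁻¹ * b⁻¹ - e * f * a = star (g - b * c * d - a⁻¹ * f⁻¹ * e⁻¹) := by
    simp [mul_assoc, *]
  have h3 : a * (b * (c * (d * (e * f)))) - a * (g * (e * f)) + 1 = 0 ↔
      g - b * c * d - a⁻¹ * f⁻¹ * e⁻¹ = 0 := by
    rw [h1]
    simp [*]
  rw [h3]
  trans g - b * c * d - a⁻¹ * f⁻¹ * e⁻¹ = 0 ∧ star (g - b * c * d - a⁻¹ * f⁻¹ * e⁻¹) = 0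
  · rw [← h2]
    simp only [← Matrix.ext_iff, Fin.forall_fin_succ]
    simp
  · rw [star_eq_zero]
    tauto

theorem rank_eq_iff_tab9 (ψ : G9 ≃g Γ.graph) {r : ℕ} (hr : r = 2 ∨ r = 3 ∨ r = 4) :
    Γ.rank = r ↔ Γ.tab9 ψ r := by
  have hB := rank_eq_of_iso ψ (B := adj9 (Γ.adjMatrix (ψ 1) (ψ 2)) (Γ.adjMatrix (ψ 2) (ψ 3))
    (Γ.adjMatrix (ψ 3) (ψ 4)) (Γ.adjMatrix (ψ 4) (ψ 1)) (Γ.adjMatrix (ψ 2) (ψ 5))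
    (Γ.adjMatrix (ψ 5) (ψ 4))) (by
      intro i j
      fin_cases i <;> fin_cases j <;>
      first
      | exact adjMatrix_eq_zero ψ ((G9_adj _ _).not.2 (by decide))
      | rfl
      | exact Γ.adjMatrix_symm _ _)
  rw [hB, rowSpaceDim_adj9 (adjMatrix_ne_zero ψ ((G9_adj _ _).2 (by decide))), tab9]
  simp only [type1_four, type2_four]
  clear hB
  have ha := adjMatrix_ne_zero ψ ((G9_adj 1 2).2 (by decide))
  have sa := Γ.star_adjMatrix (ψ 1) (ψ 2)
  have hb := adjMatrix_ne_zero ψ ((G9_adj 2 3).2 (by decide))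
  have sb := Γ.star_adjMatrix (ψ 2) (ψ 3)
  have sc := Γ.star_adjMatrix (ψ 3) (ψ 4)
  have hd := adjMatrix_ne_zero ψ ((G9_adj 4 1).2 (by decide))
  have sd := Γ.star_adjMatrix (ψ 4) (ψ 1)
  have he := adjMatrix_ne_zero ψ ((G9_adj 2 5).2 (by decide))
  have se := Γ.star_adjMatrix (ψ 2) (ψ 5)
  have sf := Γ.star_adjMatrix (ψ 5) (ψ 4)
  generalize Γ.adjMatrix (ψ 1) (ψ 2) = a at *
  generalize Γ.adjMatrix (ψ 2) (ψ 3) = b at *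
  generalize Γ.adjMatrix (ψ 3) (ψ 4) = c at *
  generalize Γ.adjMatrix (ψ 4) (ψ 1) = d at *
  generalize Γ.adjMatrix (ψ 2) (ψ 5) = e at *
  generalize Γ.adjMatrix (ψ 5) (ψ 4) = f at *
  have h1 : a * b * c * d = 1 ↔ c - b⁻¹ * a⁻¹ * d⁻¹ = 0 := by
    rw [mul_eq_one_comm, ← mul_assoc, ← sub_inv_eq_zero_iff (u := d * (a * b)) (by simp [*])]
    simp [mul_assoc]
  have h2 : c⁻¹ - d * a * b = star (c - b⁻¹ * a⁻¹ * d⁻¹) := by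
    simp [mul_assoc, *]
  have h3 : a * e * f * d = 1 ↔ f - e⁻¹ * a⁻¹ * d⁻¹ = 0 := by
    rw [mul_eq_one_comm, ← mul_assoc, ← sub_inv_eq_zero_iff (u := d * (a * e)) (by simp [*])]
    simp [mul_assoc]
  have h4 : f⁻¹ - d * a * e = star (f - e⁻¹ * a⁻¹ * d⁻¹) := by
    simp [mul_assoc, *]
  rw [h2, h4, ne_eq, ne_eq, h1, h3]
  generalize f - e⁻¹ * a⁻¹ * d⁻¹ = x
  generalize c - b⁻¹ * a⁻¹ * d⁻¹ = y
  -- `x` and `y` measure the two quadrangles. The residue has rank 0 or 2, never 1, which is why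
  -- rank 3 does not occur.
  by_cases h : x = 0 ∧ y = 0
  · obtain ⟨rfl, rfl⟩ := h
    rw [rowSpaceDim_eq_zero_iff.2]
    · simp only [not_true_eq_false, and_self, and_true, and_false, or_false]
      omega
    · simp only [← Matrix.ext_iff, Fin.forall_fin_succ]
      simp
  · rw [rowSpaceDim_border]
    · by_cases hy : y = 0 <;> by_cases hx : x = 0 <;> simp_all <;> omega
    · rw [star_ne_zero, star_ne_zero]
      tauto

theorem rank_eq_iff_tab10 (ψ : G10 ≃g Γ.graph) {r : ℕ} (hr : r = 2 ∨ r = 3 ∨ r = 4) :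
    Γ.rank = r ↔ Γ.tab10 ψ r := by
  have hB := rank_eq_of_iso ψ (B := adj10 (Γ.adjMatrix (ψ 1) (ψ 2)) (Γ.adjMatrix (ψ 2) (ψ 3))
    (Γ.adjMatrix (ψ 3) (ψ 4)) (Γ.adjMatrix (ψ 4) (ψ 5)) (Γ.adjMatrix (ψ 5) (ψ 1))
    (Γ.adjMatrix (ψ 2) (ψ 6)) (Γ.adjMatrix (ψ 6) (ψ 5))) (by
      intro i j
      fin_cases i <;> fin_cases j <;>
      first
      | exact adjMatrix_eq_zero ψ ((G10_adj _ _).not.2 (by decide))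
      | rfl
      | exact Γ.adjMatrix_symm _ _)
  rw [hB, rowSpaceDim_adj10 (adjMatrix_ne_zero ψ ((G10_adj _ _).2 (by decide)))
    (adjMatrix_ne_zero ψ ((G10_adj _ _).2 (by decide))), tab10]
  refine add_four_eq_iff hr ?_
  rw [rowSpaceDim_eq_zero_iff, type1_four, type4_five]
  clear hB
  have ha := adjMatrix_ne_zero ψ ((G10_adj 1 2).2 (by decide))
  have sa := Γ.star_adjMatrix (ψ 1) (ψ 2)
  have sb := Γ.star_adjMatrix (ψ 2) (ψ 3)
  have sc := Γ.star_adjMatrix (ψ 3) (ψ 4)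
  have sd := Γ.star_adjMatrix (ψ 4) (ψ 5)
  have he := adjMatrix_ne_zero ψ ((G10_adj 5 1).2 (by decide))
  have se := Γ.star_adjMatrix (ψ 5) (ψ 1)
  have hf := adjMatrix_ne_zero ψ ((G10_adj 2 6).2 (by decide))
  have sf := Γ.star_adjMatrix (ψ 2) (ψ 6)
  have sg := Γ.star_adjMatrix (ψ 6) (ψ 5)
  generalize Γ.adjMatrix (ψ 1) (ψ 2) = a at *
  generalize Γ.adjMatrix (ψ 2) (ψ 3) = b at *
  generalize Γ.adjMatrix (ψ 3) (ψ 4) = c at *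
  generalize Γ.adjMatrix (ψ 4) (ψ 5) = d at *
  generalize Γ.adjMatrix (ψ 5) (ψ 1) = e at *
  generalize Γ.adjMatrix (ψ 2) (ψ 6) = f at *
  generalize Γ.adjMatrix (ψ 6) (ψ 5) = g at *
  have h1 : g - f⁻¹ * a⁻¹ * e⁻¹ = 0 ↔ a * f * g * e = 1 := by
    rw [mul_eq_one_comm, ← mul_assoc, ← sub_inv_eq_zero_iff (u := e * (a * f)) (by simp [*])]
    simp [mul_assoc]
  have h2 : g⁻¹ - e * a * f = star (g - f⁻¹ * a⁻¹ * e⁻¹) := by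
    simp [mul_assoc, *]
  have h3 : d⁻¹ * c⁻¹ * b⁻¹ * a⁻¹ * e⁻¹ + e * a * b * c * d = 0 ↔ (a * b * c * d * e).re = 0 := by
    rw [re_mul_comm, ← star_add_self_eq_zero_iff]
    simp [mul_assoc, *]
  rw [← h1, ← h3]
  trans g - f⁻¹ * a⁻¹ * e⁻¹ = 0 ∧ star (g - f⁻¹ * a⁻¹ * e⁻¹) = 0 ∧
    d⁻¹ * c⁻¹ * b⁻¹ * a⁻¹ * e⁻¹ + e * a * b * c * d = 0
  · rw [← h2]
    simp only [← Matrix.ext_iff, Fin.forall_fin_succ]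
    simp
  · rw [star_eq_zero]
    tauto

theorem rank_eq_iff_tab11 (ψ : G11 ≃g Γ.graph) {r : ℕ} (hr : r = 2 ∨ r = 3 ∨ r = 4) :
    Γ.rank = r ↔ Γ.tab11 ψ r := by
  have hB := rank_eq_of_iso ψ (B := adj11 (Γ.adjMatrix (ψ 1) (ψ 2)) (Γ.adjMatrix (ψ 2) (ψ 3))
    (Γ.adjMatrix (ψ 3) (ψ 4)) (Γ.adjMatrix (ψ 4) (ψ 5)) (Γ.adjMatrix (ψ 5) (ψ 6))
    (Γ.adjMatrix (ψ 6) (ψ 1)) (Γ.adjMatrix (ψ 2) (ψ 7)) (Γ.adjMatrix (ψ 7) (ψ 6))) (by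
      intro i j
      fin_cases i <;> fin_cases j <;>
      first
      | exact adjMatrix_eq_zero ψ ((G11_adj _ _).not.2 (by decide))
      | rfl
      | exact Γ.adjMatrix_symm _ _)
  rw [hB, rowSpaceDim_adj11 (adjMatrix_ne_zero ψ ((G11_adj _ _).2 (by decide)))
    (adjMatrix_ne_zero ψ ((G11_adj _ _).2 (by decide))), tab11]
  refine add_four_eq_iff hr ?_
  rw [rowSpaceDim_eq_zero_iff, type1_four, type1_six]
  clear hB
  have ha := adjMatrix_ne_zero ψ ((G11_adj 1 2).2 (by decide))
  have sa := Γ.star_adjMatrix (ψ 1) (ψ 2)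
  have hb := adjMatrix_ne_zero ψ ((G11_adj 2 3).2 (by decide))
  have sb := Γ.star_adjMatrix (ψ 2) (ψ 3)
  have hc := adjMatrix_ne_zero ψ ((G11_adj 3 4).2 (by decide))
  have sc := Γ.star_adjMatrix (ψ 3) (ψ 4)
  have hd := adjMatrix_ne_zero ψ ((G11_adj 4 5).2 (by decide))
  have sd := Γ.star_adjMatrix (ψ 4) (ψ 5)
  have se := Γ.star_adjMatrix (ψ 5) (ψ 6)
  have hf := adjMatrix_ne_zero ψ ((G11_adj 6 1).2 (by decide))
  have sf := Γ.star_adjMatrix (ψ 6) (ψ 1)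
  have hg := adjMatrix_ne_zero ψ ((G11_adj 2 7).2 (by decide))
  have sg := Γ.star_adjMatrix (ψ 2) (ψ 7)
  have sh := Γ.star_adjMatrix (ψ 7) (ψ 6)
  generalize Γ.adjMatrix (ψ 1) (ψ 2) = a at *
  generalize Γ.adjMatrix (ψ 2) (ψ 3) = b at *
  generalize Γ.adjMatrix (ψ 3) (ψ 4) = c at *
  generalize Γ.adjMatrix (ψ 4) (ψ 5) = d at *
  generalize Γ.adjMatrix (ψ 5) (ψ 6) = e at *
  generalize Γ.adjMatrix (ψ 6) (ψ 1) = f at *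
  generalize Γ.adjMatrix (ψ 2) (ψ 7) = g at *
  generalize Γ.adjMatrix (ψ 7) (ψ 6) = h at *
  have h1 : h - g⁻¹ * a⁻¹ * f⁻¹ = 0 ↔ a * g * h * f = 1 := by
    rw [mul_eq_one_comm, ← mul_assoc, ← sub_inv_eq_zero_iff (u := f * (a * g)) (by simp [*])]
    simp [mul_assoc]
  have h2 : h⁻¹ - f * a * g = star (h - g⁻¹ * a⁻¹ * f⁻¹) := by
    simp [mul_assoc, *]
  have h3 : e + d⁻¹ * c⁻¹ * b⁻¹ * a⁻¹ * f⁻¹ = 0 ↔ a * b * c * d * e * f = -1 := by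
    have h : a * b * c * d * e * f = -(a * b * c * d * -e * f) := by simp
    rw [h, neg_inj, mul_eq_one_comm, ← mul_assoc,
      ← sub_inv_eq_zero_iff (u := f * (a * b * c * d)) (by simp [*]), ← neg_add', neg_eq_zero]
    simp [mul_assoc]
  have h4 : e⁻¹ + f * a * b * c * d = star (e + d⁻¹ * c⁻¹ * b⁻¹ * a⁻¹ * f⁻¹) := by
    simp [mul_assoc, *]
  rw [← h1, ← h3]
  trans h - g⁻¹ * a⁻¹ * f⁻¹ = 0 ∧ e + d⁻¹ * c⁻¹ * b⁻¹ * a⁻¹ * f⁻¹ = 0 ∧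
    star (h - g⁻¹ * a⁻¹ * f⁻¹) = 0 ∧ star (e + d⁻¹ * c⁻¹ * b⁻¹ * a⁻¹ * f⁻¹) = 0
  · rw [← h2, ← h4]
    simp only [← Matrix.ext_iff, Fin.forall_fin_succ]
    simp
  · rw [star_eq_zero, star_eq_zero]
    tauto

end UQGainGraph

/-! ### Underlying graphs of rank at most four. -/

namespace UQGainGraph

open Unfolding

variable {V : Type*} [Fintype V] {Γ : UQGainGraph V}

/-- Rank at most 4 rules out triangular arrays of length five, and connectedness without pendant
vertices gives minimum degree 2, so the search applies. -/
theorem nonempty_iso_of_rank_le_four (hΓ : Γ.IsConnectedBicyclic)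
    (hpend : ∀ v : V, ¬ Γ.IsPendant v) (hr : Γ.rank ≤ 4) :
    Nonempty (G1 ≃g Γ.graph) ∨ Nonempty (G2 ≃g Γ.graph) ∨ Nonempty (G3 ≃g Γ.graph) ∨
    Nonempty (G5 ≃g Γ.graph) ∨ Nonempty (G6 ≃g Γ.graph) ∨ Nonempty (G7 ≃g Γ.graph) ∨
    Nonempty (G8 ≃g Γ.graph) ∨ Nonempty (G9 ≃g Γ.graph) ∨ Nonempty (G10 ≃g Γ.graph) ∨
    Nonempty (G11 ≃g Γ.graph) := by
  classical
  obtain ⟨hconn, hedges⟩ := hΓ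
  have hedges' : Γ.graph.edgeFinset.card = Fintype.card V + 1 := by
    rw [← hedges, ← SimpleGraph.coe_edgeFinset, Set.ncard_coe_finset]
  -- With at most one vertex there are no edges, contradicting the edge count; nontriviality makes
  -- every degree positive.
  have hnt : Nontrivial V := by
    by_contra h
    rw [not_nontrivial_iff_subsingleton] at h
    have : Γ.graph.edgeFinset = ∅ := by
      simp [SimpleGraph.edgeFinset_eq_empty, Subsingleton.elim Γ.graph ⊥]
    rw [this] at hedges'
    simp at hedges'
  have hdeg : ∀ v, 2 ≤ Γ.graph.degree v := by
    intro v
    have h1 := hconn.preconnected.degree_pos_of_nontrivial v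
    have h2 : Γ.graph.degree v ≠ 1 := by
      intro h
      apply hpend v
      rw [IsPendant, Set.ncard_eq_toFinset_card']
      exact h
    omega
  obtain ⟨p, hp, h⟩ := exists_hasPattern hconn hdeg hedges' fun l hl => by
    have := hl.length_le (A := Γ.adjMatrix) fun u v => Γ.adjMatrix_ne_zero_iff
    rw [← leftRowRank_eq_rowSpaceDim] at this
    exact Nat.lt_succ_of_le (this.trans hr)
  simp only [patterns, List.mem_cons, List.not_mem_nil, or_false] at hp
  rcases hp with rfl | rfl | rfl | rfl | rfl | rfl | rfl | rfl | rfl | rfl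
  · have := h.nonempty_iso rfl _ G1_adj
    tauto
  · have := h.nonempty_iso rfl _ G2_adj
    tauto
  · have := h.nonempty_iso rfl _ G3_adj
    tauto
  · have := h.nonempty_iso rfl _ G5_adj
    tauto
  · have := h.nonempty_iso rfl _ G6_adj
    tauto
  · have := h.nonempty_iso rfl _ G7_adj
    tauto
  · have := h.nonempty_iso rfl _ G8_adj
    tauto
  · have := h.nonempty_iso rfl _ G9_adj
    tauto
  · have := h.nonempty_iso rfl _ G10_adj
    tauto
  · have := h.nonempty_iso rfl _ G11_adj
    tauto

end UQGainGraph

end QuaternionGain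

end

open QuaternionGain in
/-- Let `Γ` be a connected bicyclic quaternion unit gain graph without pendant vertices, and let
`r` be 2, 3 or 4. Then `Γ` has rank `r` if and only if, under some labelling, it is one of the
graphs listed for rank `r` and satisfies the gain condition listed there; and for
every labelling of `Γ` as one of the eleven graphs, the rank is `r` if and only if the gain
condition listed for this graph and this rank holds. -/
theorem theorem4p4 {V : Type*} [Fintype V] (Γ : UQGainGraph V)
    (hΓ : Γ.IsConnectedBicyclic) (hpend : ∀ v : V, ¬ Γ.IsPendant v)
    (r : ℕ) (hr : r = 2 ∨ r = 3 ∨ r = 4) :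
    (Γ.rank = r ↔
      (∃ e : G1 ≃g Γ.graph, Γ.tab1 e r) ∨
      (∃ e : G2 ≃g Γ.graph, Γ.tab2 e r) ∨
      (∃ e : G3 ≃g Γ.graph, Γ.tab3 e r) ∨
      (∃ e : G4 ≃g Γ.graph, Γ.tab4 e r) ∨
      (∃ e : G5 ≃g Γ.graph, Γ.tab5 e r) ∨
      (∃ e : G6 ≃g Γ.graph, Γ.tab6 e r) ∨
      (∃ e : G7 ≃g Γ.graph, Γ.tab7 e r) ∨
      (∃ e : G8 ≃g Γ.graph, Γ.tab8 e r) ∨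
      (∃ e : G9 ≃g Γ.graph, Γ.tab9 e r) ∨
      (∃ e : G10 ≃g Γ.graph, Γ.tab10 e r) ∨
      (∃ e : G11 ≃g Γ.graph, Γ.tab11 e r)) ∧
    (∀ e : G1 ≃g Γ.graph, Γ.rank = r ↔ Γ.tab1 e r) ∧
    (∀ e : G2 ≃g Γ.graph, Γ.rank = r ↔ Γ.tab2 e r) ∧
    (∀ e : G3 ≃g Γ.graph, Γ.rank = r ↔ Γ.tab3 e r) ∧
    (∀ e : G4 ≃g Γ.graph, Γ.rank = r ↔ Γ.tab4 e r) ∧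
    (∀ e : G5 ≃g Γ.graph, Γ.rank = r ↔ Γ.tab5 e r) ∧
    (∀ e : G6 ≃g Γ.graph, Γ.rank = r ↔ Γ.tab6 e r) ∧
    (∀ e : G7 ≃g Γ.graph, Γ.rank = r ↔ Γ.tab7 e r) ∧
    (∀ e : G8 ≃g Γ.graph, Γ.rank = r ↔ Γ.tab8 e r) ∧
    (∀ e : G9 ≃g Γ.graph, Γ.rank = r ↔ Γ.tab9 e r) ∧
    (∀ e : G10 ≃g Γ.graph, Γ.rank = r ↔ Γ.tab10 e r) ∧
    (∀ e : G11 ≃g Γ.graph, Γ.rank = r ↔ Γ.tab11 e r) := by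
  have h1 := fun ψ => UQGainGraph.rank_eq_iff_tab1 (Γ := Γ) ψ hr
  have h2 := fun ψ => UQGainGraph.rank_eq_iff_tab2 (Γ := Γ) ψ hr
  have h3 := fun ψ => UQGainGraph.rank_eq_iff_tab3 (Γ := Γ) ψ hr
  have h4 := fun ψ => UQGainGraph.rank_eq_iff_tab4 (Γ := Γ) ψ hr
  have h5 := fun ψ => UQGainGraph.rank_eq_iff_tab5 (Γ := Γ) ψ hr
  have h6 := fun ψ => UQGainGraph.rank_eq_iff_tab6 (Γ := Γ) ψ hr
  have h7 := fun ψ => UQGainGraph.rank_eq_iff_tab7 (Γ := Γ) ψ hr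
  have h8 := fun ψ => UQGainGraph.rank_eq_iff_tab8 (Γ := Γ) ψ hr
  have h9 := fun ψ => UQGainGraph.rank_eq_iff_tab9 (Γ := Γ) ψ hr
  have h10 := fun ψ => UQGainGraph.rank_eq_iff_tab10 (Γ := Γ) ψ hr
  have h11 := fun ψ => UQGainGraph.rank_eq_iff_tab11 (Γ := Γ) ψ hr
  refine ⟨⟨fun h => ?_, ?_⟩, h1, h2, h3, h4, h5, h6, h7, h8, h9, h10, h11⟩
  -- Ten cases suffice: `G4` never has rank at most 4.
  · rcases UQGainGraph.nonempty_iso_of_rank_le_four hΓ hpend (by omega) with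
      ⟨⟨ψ⟩⟩ | ⟨⟨ψ⟩⟩ | ⟨⟨ψ⟩⟩ | ⟨⟨ψ⟩⟩ | ⟨⟨ψ⟩⟩ | ⟨⟨ψ⟩⟩ | ⟨⟨ψ⟩⟩ | ⟨⟨ψ⟩⟩ | ⟨⟨ψ⟩⟩ | ⟨⟨ψ⟩⟩
    · have h' : ∃ ψ : G1 ≃g Γ.graph, Γ.tab1 ψ r := ⟨ψ, (h1 ψ).1 h⟩
      tauto
    · have h' : ∃ ψ : G2 ≃g Γ.graph, Γ.tab2 ψ r := ⟨ψ, (h2 ψ).1 h⟩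
      tauto
    · have h' : ∃ ψ : G3 ≃g Γ.graph, Γ.tab3 ψ r := ⟨ψ, (h3 ψ).1 h⟩
      tauto
    · have h' : ∃ ψ : G5 ≃g Γ.graph, Γ.tab5 ψ r := ⟨ψ, (h5 ψ).1 h⟩
      tauto
    · have h' : ∃ ψ : G6 ≃g Γ.graph, Γ.tab6 ψ r := ⟨ψ, (h6 ψ).1 h⟩
      tauto
    · have h' : ∃ ψ : G7 ≃g Γ.graph, Γ.tab7 ψ r := ⟨ψ, (h7 ψ).1 h⟩
      tauto
    · have h' : ∃ ψ : G8 ≃g Γ.graph, Γ.tab8 ψ r := ⟨ψ, (h8 ψ).1 h⟩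
      tauto
    · have h' : ∃ ψ : G9 ≃g Γ.graph, Γ.tab9 ψ r := ⟨ψ, (h9 ψ).1 h⟩
      tauto
    · have h' : ∃ ψ : G10 ≃g Γ.graph, Γ.tab10 ψ r := ⟨ψ, (h10 ψ).1 h⟩
      tauto
    · have h' : ∃ ψ : G11 ≃g Γ.graph, Γ.tab11 ψ r := ⟨ψ, (h11 ψ).1 h⟩
      tauto
  · rintro (⟨ψ, h⟩ | ⟨ψ, h⟩ | ⟨ψ, h⟩ | ⟨ψ, h⟩ | ⟨ψ, h⟩ | ⟨ψ, h⟩ |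
      ⟨ψ, h⟩ | ⟨ψ, h⟩ | ⟨ψ, h⟩ | ⟨ψ, h⟩ | ⟨ψ, h⟩)
    · exact (h1 ψ).2 h
    · exact (h2 ψ).2 h
    · exact (h3 ψ).2 h
    · exact (h4 ψ).2 h
    · exact (h5 ψ).2 h
    · exact (h6 ψ).2 h
    · exact (h7 ψ).2 h
    · exact (h8 ψ).2 h
    · exact (h9 ψ).2 h
    · exact (h10 ψ).2 h
    · exact (h11 ψ).2 h
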